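/- Let $f,g,\phi:\mathbb{T}=\mathbb{R}/\mathbb{Z}\to\mathbb{R}$ be real analytic. Assume that $f$ is nonconstant, that $v=g/f$ is nonconstant on $\{f\neq 0\}$, that $f$ has at least one zero on $\mathbb{T}$, and that $\|f\|_\infty\le 1$. Assume that the Fourier coefficients $\hat\phi(n)=\int_0^1\phi(x)e^{-2\pi i n x}\,dx$ satisfy $\hat\phi(0)=0$ and, for some $\rho>0$, $|\hat\phi(n)|<e^{-\rho|n|}$ for all $n\in\mathbb{Z}$. For $\epsilon>0$, $\omega,x,E\in\mathbb{R}$ and an integer $N\ge 1$ let $B_N(x,E)$ be the $N\times N$ matrix with entries, for $0\le n,n'<N$, $$B_N(x,E)(n,n)=\frac{g(x+n\omega)-Ef(x+n\omega)}{\sqrt{1+E^2}},\qquad B_N(x,E)(n,n')=\frac{\epsilon}{\sqrt{1+E^2}}\,f(x+n\omega)\,\hat\phi(n-n')\quad(n\ne n').$$ (Thus $H_N(x)-E=F_N(x,E)B_N(x,E)$ whenever $f(x+n\omega)\neq0$ for $0\le n<N$, where $H_N(x)(n,n')=v(x+n\omega)\delta_{nn'}+\epsilon\hat\phi(n-n')$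 and $F_N(x,E)$ is the diagonal matrix with entries $\sqrt{1+E^2}/f(x+n\omega)$.) Call $\omega$ Diophantine if there are $a,A>0$ with $\operatorname{dist}(k\omega,\mathbb{Z})>a|k|^{-A}$ for all $k\in\mathbb{Z}\setminus\{0\}$. Then for every $\kappa>0$ there is $\epsilon_1=\epsilon_1(\kappa,\phi,f,g)>0$ such that for all $0<\epsilon<\epsilon_0\le\epsilon_1$, all Diophantine $\omega$, all integers $N\ge1$ and all $E\in\mathbb{R}$, the functions $\det B_N(\cdot,E)$ and $g-Ef$ are nonzero almost everywhere, $\log|\det B_N(\cdot,E)|$ and $\log\frac{|g-Ef|}{\sqrt{1+E^2}}$ are integrable on $\mathbb{T}$, and $$\frac1N\int_{\mathbb{T}}\log|\det B_N(x,E)|\,dx>\int_{\mathbb{T}}\log\frac{|g(x)-Ef(x)|}{\sqrt{1+E^2}}\,dx-\bigl(\kappa+\epsilon_0^{1/4}\bigr).$$ -/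

import Mathlib

namespace SingularLongRange

/-- The Diophantine condition: `‖k ω‖ > a |k|^(-A)` for all nonzero integers `k`, for some
`a > 0`, `A > 0`, where `‖y‖ = |y - round y|` is the distance of `y` to the integers. -/
def IsDiophantine (ω : ℝ) : Prop :=
  ∃ a A : ℝ, 0 < a ∧ 0 < A ∧ ∀ k : ℤ, k ≠ 0 →
    a * |(k : ℝ)| ^ (-A) < |(k : ℝ) * ω - round ((k : ℝ) * ω)|

/-- A real analytic function on the circle `ℝ / ℤ`, given as a 1-periodic real analytic
function on the line. -/
def IsAnalyticOnCircle (h : ℝ → ℝ) : Prop :=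
  AnalyticOnNhd ℝ h Set.univ ∧ Function.Periodic h 1

/-- The `n`-th Fourier coefficient `∫₀¹ φ(x) exp(-2πinx) dx` of a 1-periodic function. -/
noncomputable def fourierHat (φ : ℝ → ℝ) (n : ℤ) : ℂ :=
  fourierCoeffOn (zero_lt_one : (0 : ℝ) < 1) (fun x => (φ x : ℂ)) n

/-- The restriction to `[0, N)` of the long-range operator
`(g / f)(x + nω) δ_{nn'} + ε φ̂(n - n')`. -/
noncomputable def matrixH (f g φ : ℝ → ℝ) (ε ω : ℝ) (N : ℕ) (x : ℝ) :
    Matrix (Fin N) (Fin N) ℂ :=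
  Matrix.of fun n n' =>
    (if n = n' then ((g (x + (n : ℕ) * ω) / f (x + (n : ℕ) * ω) : ℝ) : ℂ) else 0)
      + (ε : ℂ) * fourierHat φ (((n : ℕ) : ℤ) - ((n' : ℕ) : ℤ))

/-- The diagonal matrix with entries `√(1 + E²) / f(x + nω)`. -/
noncomputable def matrixF (f : ℝ → ℝ) (ω : ℝ) (N : ℕ) (x E : ℝ) :
    Matrix (Fin N) (Fin N) ℂ :=
  Matrix.diagonal fun n => ((Real.sqrt (1 + E ^ 2) / f (x + (n : ℕ) * ω) : ℝ) : ℂ)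

/-- The normalized matrix `B_N(x, E)`, with diagonal entries
`(g(x + nω) - E f(x + nω)) / √(1 + E²)` and off-diagonal entries
`ε f(x + nω) φ̂(n - n') / √(1 + E²)`. -/
noncomputable def matrixB (f g φ : ℝ → ℝ) (ε ω : ℝ) (N : ℕ) (x E : ℝ) :
    Matrix (Fin N) (Fin N) ℂ :=
  Matrix.of fun n n' =>
    if n = n' then
      (((g (x + (n : ℕ) * ω) - E * f (x + (n : ℕ) * ω)) / Real.sqrt (1 + E ^ 2) : ℝ) : ℂ)
    else
      ((ε / Real.sqrt (1 + E ^ 2) * f (x + (n : ℕ) * ω) : ℝ) : ℂ)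
        * fourierHat φ (((n : ℕ) : ℤ) - ((n' : ℕ) : ℤ))

/-- `H_N - E = F_N B_N` wherever the operator is defined. -/
theorem matrixH_sub_eq (f g φ : ℝ → ℝ) (ε ω : ℝ) (N : ℕ) (x E : ℝ)
    (hφ : fourierHat φ 0 = 0) (hx : ∀ n : ℕ, n < N → f (x + n * ω) ≠ 0) :
    matrixH f g φ ε ω N x - (E : ℂ) • (1 : Matrix (Fin N) (Fin N) ℂ)
      = matrixF f ω N x E * matrixB f g φ ε ω N x E := by
  have hs : Real.sqrt (1 + E ^ 2) ≠ 0 := (Real.sqrt_pos.2 (by positivity)).ne'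
  have hs' : ((Real.sqrt (1 + E ^ 2) : ℝ) : ℂ) ≠ 0 := by exact_mod_cast hs
  ext n n'
  have hf : ((f (x + (n : ℕ) * ω) : ℝ) : ℂ) ≠ 0 := by exact_mod_cast hx n n.isLt
  by_cases h : n = n'
  · subst h
    simp only [matrixF, Matrix.diagonal_mul, matrixH, matrixB, Matrix.sub_apply,
      Matrix.smul_apply, Matrix.of_apply, Matrix.one_apply_eq, if_true, sub_self, hφ]
    push_cast
    field_simp
    simp
  · simp only [matrixF, Matrix.diagonal_mul, matrixH, matrixB, Matrix.sub_apply,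
      Matrix.smul_apply, Matrix.of_apply, Matrix.one_apply_ne h, if_neg h]
    push_cast
    field_simp
    simp

end SingularLongRange

namespace SingularLongRange

/-! On the real line the diagonal entries of `B_N` may vanish, so `det B_N` cannot be compared there
with the product of its diagonal. The comparison is made off the real line and carried back by
convexity. Write `(a, b)` for `(1, E) / √(1 + E²)` and extend `f`, `g` to periodic holomorphic `F`,
`G` on a strip. Let `J(y)` and `I(y)` be the means over `Im z = y` of `log ‖a G - b F‖` and of `log
‖det B_N‖`. On a line where `a G - b F` has no zeros it is bounded below; for small `ε`, whatever
`N` and `ω`, the rows of `B_N` are then dominated by the diagonal, and Gershgorin gives `|I(y) - N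
J(y)| ≤ 2ηN` (`abs_integral_log_norm_det_sub_le`). By Jensen's formula `I` is convex
(`convexOn_integral_log_norm`). Hence `I(0) ≥ 2 I(y) - I(2y) ≥ N (2 J(y) - J(2y) - 6η)`. Since `J`
is also convex, it is continuous at `0`, so `2 J(y) - J(2y)` is close to `J(0)` for small `y`
(`exists_height`). Uniformity in `E` comes from compactness of the circle `a² + b² = 1`, which
includes the limits `E → ±∞`. The heights are chosen at a centre `(a₀, b₀)`; for nearby `(a, b)` the
change is absorbed into the diagonal perturbation, and upper semicontinuity of the logarithmic mean
(`exists_integral_log_norm_le_add`) replaces `J(0)` at the centre by its value at `(a, b)`. -/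

section

open Complex MeasureTheory Metric Real Set Filter Topology

/-! ### Logarithmic means on annuli -/

/-- The closed annulus `exp a ≤ ‖z‖ ≤ exp b`. -/
def annulus (a b : ℝ) : Set ℂ := {z | ‖z‖ ∈ Icc (Real.exp a) (Real.exp b)}

theorem circleMap_mem_annulus {a b t : ℝ} (ht : t ∈ Icc a b) (θ : ℝ) :
    circleMap 0 (Real.exp t) θ ∈ annulus a b := by
  simp only [annulus, mem_ofPred_eq, norm_circleMap_zero, abs_of_pos (Real.exp_pos t), mem_Icc,
    Real.exp_le_exp]
  exact ht

theorem isCompact_annulus (a b : ℝ) : IsCompact (annulus a b) := by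
  refine Metric.isCompact_of_isClosed_isBounded ?_ ?_
  · exact isClosed_Icc.preimage continuous_norm
  · exact (isBounded_closedBall (x := (0 : ℂ)) (r := Real.exp b)).subset fun z hz => by
      simpa using hz.2

theorem ne_zero_of_mem_annulus {a b : ℝ} {z : ℂ} (hz : z ∈ annulus a b) : z ≠ 0 := by
  rintro rfl
  have := hz.1
  simp only [norm_zero] at this
  exact absurd (Real.exp_pos a) (not_lt.2 this)

/-- Cauchy's theorem for `F z / z`, whose pole at `0` lies outside the annulus. -/
theorem circleAverage_eq_of_analyticOnNhd_annulus {a b s t : ℝ} {F : ℂ → ℂ}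
    (hF : AnalyticOnNhd ℂ F (annulus a b)) (hs : s ∈ Icc a b) (ht : t ∈ Icc a b) (hst : s ≤ t) :
    circleAverage F 0 (Real.exp t) = circleAverage F 0 (Real.exp s) := by
  rw [circleAverage_eq_circleIntegral (Real.exp_pos t).ne',
    circleAverage_eq_circleIntegral (Real.exp_pos s).ne']
  congr 1
  have hsub : closedBall (0 : ℂ) (Real.exp t) \ ball 0 (Real.exp s) ⊆ annulus a b := by
    rintro z ⟨h1, h2⟩
    simp only [mem_closedBall, dist_zero_right, mem_ball, not_lt] at h1 h2
    exact ⟨(Real.exp_le_exp.2 hs.1).trans h2, h1.trans (Real.exp_le_exp.2 ht.2)⟩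
  refine circleIntegral_sub_center_inv_smul_eq_of_differentiable_on_annulus_off_countable
    (Real.exp_pos s) (Real.exp_le_exp.2 hst) countable_empty (hF.continuousOn.mono hsub) ?_
  rintro z ⟨⟨h1, h2⟩, -⟩
  refine (hF z (hsub ⟨ball_subset_closedBall h1, fun h => h2 (ball_subset_closedBall h)⟩)).differentiableAt

/-- Logarithmic means of a zero-free analytic function on an annulus are affine in the logarithm of
the radius. -/
theorem circleAverage_log_norm_affine {a b : ℝ} {g : ℂ → ℂ}
    (hg : AnalyticOnNhd ℂ g (annulus a b)) (hg0 : ∀ z ∈ annulus a b, g z ≠ 0) :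
    ∃ A k : ℝ, ∀ t ∈ Icc a b,
      circleAverage (fun z => Real.log ‖g z‖) 0 (Real.exp t) = A + k * t := by
  rcases lt_or_ge b a with hab | hab
  · exact ⟨0, 0, fun t ht => absurd (ht.1.trans ht.2) (not_le.2 hab)⟩
  -- `Re (z g' / g)` is the derivative of `log ‖g‖` in the logarithm of the radius. Its circle
  -- average does not depend on the radius, and this constant is the slope `k`.
  set F : ℂ → ℂ := fun z => z * deriv g z / g z with hFdef
  have hF : AnalyticOnNhd ℂ F (annulus a b) := fun z hz =>
    (analyticAt_id.mul (hg z hz).deriv).div (hg z hz) (hg0 z hz)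
  set k : ℝ := (circleAverage F 0 (Real.exp a)).re with hk
  have ha : a ∈ Icc a b := ⟨le_rfl, hab⟩
  refine ⟨circleAverage (fun z => Real.log ‖g z‖) 0 (Real.exp a) - k * a, k, fun t ht => ?_⟩
  have hmap : Continuous fun p : ℝ × ℝ => circleMap 0 (Real.exp p.1) p.2 := by
    unfold circleMap; fun_prop
  have hcontF : ContinuousOn (fun p : ℝ × ℝ => (F (circleMap 0 (Real.exp p.1) p.2)).re)
      (Icc a b ×ˢ univ) :=
    Complex.continuous_re.comp_continuousOn
      (hF.continuousOn.comp hmap.continuousOn fun p hp => circleMap_mem_annulus hp.1 _)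
  have hderiv : ∀ θ : ℝ, ∀ τ ∈ Icc a b,
      HasDerivAt (fun τ => Real.log ‖g (circleMap 0 (Real.exp τ) θ)‖)
        (F (circleMap 0 (Real.exp τ) θ)).re τ := by
    intro θ τ hτ
    have hz := circleMap_mem_annulus hτ θ
    have h1 : HasDerivAt (fun τ : ℝ => circleMap 0 (Real.exp τ) θ) (circleMap 0 (Real.exp τ) θ) τ := by
      have := ((Real.hasDerivAt_exp τ).ofReal_comp).mul_const (Complex.exp (θ * Complex.I))
      simpa [circleMap] using this
    have h2 : HasDerivAt (fun τ : ℝ => g (circleMap 0 (Real.exp τ) θ))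
        (deriv g (circleMap 0 (Real.exp τ) θ) * circleMap 0 (Real.exp τ) θ) τ :=
      HasDerivAt.comp τ (h := fun τ : ℝ => circleMap 0 (Real.exp τ) θ) (hg _ hz).differentiableAt.hasDerivAt h1
    have h0 := hg0 _ hz
    have h3 : HasDerivAt (fun τ : ℝ => ‖g (circleMap 0 (Real.exp τ) θ)‖ ^ 2)
        (2 * inner ℝ (g (circleMap 0 (Real.exp τ) θ))
          (deriv g (circleMap 0 (Real.exp τ) θ) * circleMap 0 (Real.exp τ) θ)) τ := h2.norm_sq
    have h4 := (h3.log (by positivity)).div_const 2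
    have h5 : (fun τ : ℝ => Real.log (‖g (circleMap 0 (Real.exp τ) θ)‖ ^ 2) / 2) =
        fun τ => Real.log ‖g (circleMap 0 (Real.exp τ) θ)‖ := by
      ext τ; rw [Real.log_pow]; push_cast; ring
    rw [h5] at h4
    refine h4.congr_deriv ?_
    have hn : Complex.normSq (g (circleMap 0 (Real.exp τ) θ)) ≠ 0 := by simpa using h0
    simp only [Complex.inner, hFdef, ← Complex.normSq_eq_norm_sq, Complex.div_re, Complex.mul_re,
      Complex.mul_im, Complex.conj_re, Complex.conj_im]
    field_simp
    ring
  have hsub : uIcc a t ⊆ Icc a b := by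
    rw [uIcc_of_le ht.1]; exact Icc_subset_Icc_right ht.2
  have hconst : ∀ τ ∈ Icc a b,
      (2 * π)⁻¹ * ∫ θ in (0 : ℝ)..2 * π, (F (circleMap 0 (Real.exp τ) θ)).re = k := by
    intro τ hτ
    rw [hk, ← circleAverage_eq_of_analyticOnNhd_annulus hF ha hτ hτ.1, circleAverage_def,
      Complex.smul_re, smul_eq_mul]
    congr 1
    have hi : IntervalIntegrable (fun θ => F (circleMap 0 (Real.exp τ) θ)) volume 0 (2 * π) := by
      refine Continuous.intervalIntegrable ?_ _ _
      exact hF.continuousOn.comp_continuous (continuous_circleMap _ _)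
        fun θ => circleMap_mem_annulus hτ θ
    exact Complex.reCLM.intervalIntegral_comp_comm hi
  have hlogcont : ∀ τ ∈ Icc a b, IntervalIntegrable
      (fun θ => Real.log ‖g (circleMap 0 (Real.exp τ) θ)‖) volume 0 (2 * π) := by
    intro τ hτ
    refine Continuous.intervalIntegrable ?_ _ _
    refine Continuous.log ?_ fun θ => by simpa using hg0 _ (circleMap_mem_annulus hτ θ)
    exact (hg.continuousOn.comp_continuous (continuous_circleMap _ _)
        fun θ => circleMap_mem_annulus hτ θ).norm
  have key : circleAverage (fun z => Real.log ‖g z‖) 0 (Real.exp t)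
      - circleAverage (fun z => Real.log ‖g z‖) 0 (Real.exp a) = k * (t - a) := by
    rw [circleAverage_def, circleAverage_def, smul_eq_mul, smul_eq_mul, ← mul_sub,
      ← intervalIntegral.integral_sub (hlogcont t ht) (hlogcont a ha)]
    have hFTC : ∀ θ : ℝ, Real.log ‖g (circleMap 0 (Real.exp t) θ)‖
        - Real.log ‖g (circleMap 0 (Real.exp a) θ)‖
        = ∫ τ in a..t, (F (circleMap 0 (Real.exp τ) θ)).re := by
      intro θ
      rw [intervalIntegral.integral_eq_sub_of_hasDerivAt
        (fun τ hτ => hderiv θ τ (hsub hτ))]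
      refine ContinuousOn.intervalIntegrable ?_
      exact hcontF.comp (f := fun τ : ℝ => (τ, θ)) (by fun_prop) fun τ hτ => ⟨hsub hτ, mem_univ _⟩
    simp_rw [hFTC]
    rw [intervalIntegral_intervalIntegral_swap, ← intervalIntegral.integral_const_mul,
      intervalIntegral.integral_congr (g := fun _ => k) (fun τ hτ => hconst τ (hsub hτ)),
      intervalIntegral.integral_const, smul_eq_mul, mul_comm]
    have hc2 : ContinuousOn (Function.uncurry fun θ τ => (F (circleMap 0 (Real.exp τ) θ)).re)
        (uIcc 0 (2 * π) ×ˢ uIcc a t) :=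
      hcontF.comp (f := fun p : ℝ × ℝ => (p.2, p.1)) (by fun_prop)
        fun p hp => ⟨hsub hp.2, mem_univ _⟩
    have hint := hc2.integrableOn_compact (μ := (volume : Measure ℝ).prod volume)
      (isCompact_uIcc.prod isCompact_uIcc)
    exact hint.mono_set (prod_mono uIoc_subset_uIcc uIoc_subset_uIcc)
  linarith

/-- Jensen's formula for a single linear factor; the right side is visibly convex in `t`. -/
theorem circleAverage_log_norm_sub_const_eq_max {u : ℂ} (hu : u ≠ 0) (t : ℝ) :
    circleAverage (fun z => Real.log ‖z - u‖) 0 (Real.exp t) = max t (Real.log ‖u‖) := by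
  rw [circleAverage_log_norm_sub_const_eq_log_radius_add_posLog (Real.exp_pos t).ne', Real.log_exp,
    zero_sub, norm_neg, Real.posLog, Real.log_mul (by positivity) (by simpa using hu), Real.log_inv,
    Real.log_exp, ← max_add_add_left]
  simp

/-- Logarithmic means of an analytic function on an annulus are convex in the logarithm of the
radius. -/
theorem convexOn_circleAverage_log_norm {a b : ℝ} {G : ℂ → ℂ}
    (hG : AnalyticOnNhd ℂ G (annulus a b))
    (hG0 : ∀ u ∈ annulus a b, meromorphicOrderAt G u ≠ ⊤) :
    ConvexOn ℝ (Icc a b) fun t => circleAverage (fun z => Real.log ‖G z‖) 0 (Real.exp t) := by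
  set D := MeromorphicOn.divisor G (annulus a b) with hD
  have hfin : D.support.Finite := D.finiteSupport (isCompact_annulus a b)
  obtain ⟨g, hg, hg0, hGg⟩ := hG.meromorphicOn.extract_zeros_poles (fun u => hG0 u u.2) hfin
  have hlog := MeromorphicOn.extract_zeros_poles_log hg0 hGg
  obtain ⟨A, k, hAk⟩ := circleAverage_log_norm_affine hg fun z hz => hg0 ⟨z, hz⟩
  -- Analyticity enters here: zeros count with nonnegative weight, so the sum of the terms `max t
  -- (log ‖u‖)` stays convex.
  have hDpos : ∀ u, 0 ≤ D u := MeromorphicOn.AnalyticOnNhd.divisor_nonneg hG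
  have hsum : (∑ᶠ u, (fun z => (D u : ℝ) * Real.log ‖z - u‖)) =
      ∑ u ∈ hfin.toFinset, (fun z => (D u : ℝ) * Real.log ‖z - u‖) := by
    refine finsum_eq_sum_of_support_subset _ fun u => ?_
    contrapose
    intro h
    have : D u = 0 := by simpa using h
    simp [this]
    rfl
  have hformula : ∀ t ∈ Icc a b, circleAverage (fun z => Real.log ‖G z‖) 0 (Real.exp t) =
      (∑ u ∈ hfin.toFinset, (D u : ℝ) * max t (Real.log ‖u‖)) + (A + k * t) := by
    intro t ht
    have hsph : sphere (0 : ℂ) |Real.exp t| ⊆ annulus a b := by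
      intro z hz
      rw [abs_of_pos (Real.exp_pos t), mem_sphere_zero_iff_norm] at hz
      simp only [annulus, mem_ofPred_eq, hz, mem_Icc, Real.exp_le_exp]
      exact ht
    rw [circleAverage_congr_codiscreteWithin (codiscreteWithin_mono hsph hlog)
      (Real.exp_pos t).ne', circleAverage_add
      (circleIntegrable_log_norm_factorizedRational (D : ℂ → ℤ))
      ((hg.mono hsph).meromorphicOn.circleIntegrable_log_norm), hAk t ht]
    congr 1
    erw [hsum]
    rw [circleAverage_sum]
    · refine Finset.sum_congr rfl fun u hu => ?_
      have hu' : u ∈ annulus a b := D.supportWithinDomain (by simpa using hu)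
      rw [← circleAverage_log_norm_sub_const_eq_max (ne_zero_of_mem_annulus hu')]
      simp_rw [← smul_eq_mul, circleAverage_fun_smul]
    · intro u hu
      apply IntervalIntegrable.const_mul
      exact circleIntegrable_log_norm_sub_const _
  have hconv : ConvexOn ℝ (Icc a b) fun t =>
      (∑ u ∈ hfin.toFinset, (D u : ℝ) * max t (Real.log ‖u‖)) + (A + k * t) := by
    refine ConvexOn.add ?_ ⟨convex_Icc a b, fun x _ y _ p q _ _ hpq => le_of_eq ?_⟩
    · refine ⟨convex_Icc a b, fun x _ y _ p q hp hq hpq => ?_⟩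
      simp only [smul_eq_mul, Finset.mul_sum, ← Finset.sum_add_distrib]
      refine Finset.sum_le_sum fun u _ => ?_
      have h0 : (0 : ℝ) ≤ D u := by exact_mod_cast hDpos u
      have : max (p * x + q * y) (Real.log ‖u‖) ≤
          p * max x (Real.log ‖u‖) + q * max y (Real.log ‖u‖) := by
        refine max_le ?_ ?_
        · gcongr <;> exact le_max_left _ _
        · calc Real.log ‖u‖ = p * Real.log ‖u‖ + q * Real.log ‖u‖ := by rw [← add_mul, hpq, one_mul]
            _ ≤ _ := by gcongr <;> exact le_max_right _ _
      calc _ ≤ (D u : ℝ) * (p * max x (Real.log ‖u‖) + q * max y (Real.log ‖u‖)) := by gcongr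
        _ = _ := by ring
    · simp only [smul_eq_mul]
      linear_combination (-A) * hpq
  exact hconv.congr fun t ht => (hformula t ht).symm

/-! ### Convexity in the height on a strip -/

/-- The open horizontal strip `|Im z| < δ`. -/
def strip (δ : ℝ) : Set ℂ := {z | |z.im| < δ}

theorem mem_strip {δ : ℝ} {z : ℂ} : z ∈ strip δ ↔ |z.im| < δ := Iff.rfl

theorem isOpen_strip (δ : ℝ) : IsOpen (strip δ) :=
  isOpen_lt (by fun_prop) continuous_const

theorem isPreconnected_strip (δ : ℝ) : IsPreconnected (strip δ) := by
  have : strip δ = Complex.im ⁻¹' (Ioo (-δ) δ) := by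
    ext z; simp [mem_strip, abs_lt]
  rw [this]
  exact ((convex_Ioo (-δ) δ).linear_preimage Complex.imLm).isPreconnected

theorem line_mem_strip {δ y : ℝ} (hy : |y| < δ) (x : ℝ) : (x + y * Complex.I : ℂ) ∈ strip δ := by
  simpa [mem_strip] using hy

theorem integral_line_eq_circleAverage (h : ℂ → ℝ) (y : ℝ) :
    ∫ x in (0 : ℝ)..1, h (Function.Periodic.qParam 1 (x + y * Complex.I)) =
      circleAverage h 0 (Real.exp (-2 * π * y)) := by
  have hx : ∀ x : ℝ, Function.Periodic.qParam 1 (x + y * Complex.I) =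
      circleMap 0 (Real.exp (-2 * π * y)) (2 * π * x) := by
    intro x
    simp only [Function.Periodic.qParam, circleMap, zero_add, Complex.ofReal_exp, ← Complex.exp_add]
    congr 1
    push_cast
    linear_combination 2 * (π : ℂ) * y * Complex.I_mul_I
  simp_rw [hx]
  rw [intervalIntegral.integral_comp_mul_left
    (fun θ => h (circleMap 0 (Real.exp (-2 * π * y)) θ)) Real.two_pi_pos.ne', circleAverage_def]
  simp

/-- For a holomorphic `1`-periodic function on a strip, the mean of the logarithm of the modulus
along horizontal lines is a convex function of the height. -/
theorem convexOn_integral_log_norm {δ : ℝ} {F : ℂ → ℂ} (hper : Function.Periodic F 1)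
    (hF : DifferentiableOn ℂ F (strip δ)) (hne : ∃ z ∈ strip δ, F z ≠ 0) :
    ConvexOn ℝ (Ioo (-δ) δ) fun y => ∫ x in (0 : ℝ)..1, Real.log ‖F (x + y * Complex.I)‖ := by
  -- With `q = exp (2πiz)`, `F z = G q`: the strip becomes an open annulus `V`, and horizontal lines
  -- become circles whose log-radius is linear in the height.
  set G := Function.Periodic.cuspFunction 1 F with hGdef
  have hper' : Function.Periodic F ((1 : ℝ) : ℂ) := by simpa using hper
  have hGF : ∀ z, G (Function.Periodic.qParam 1 z) = F z :=
    Function.Periodic.eq_cuspFunction one_ne_zero hper'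
  set V := Function.Periodic.qParam 1 '' strip δ with hV
  have hVmem : ∀ z : ℂ, z ≠ 0 → |Real.log ‖z‖| < 2 * π * δ → z ∈ V := by
    intro z hz h
    refine ⟨Function.Periodic.invQParam 1 z, ?_, Function.Periodic.qParam_right_inv one_ne_zero hz⟩
    rw [mem_strip, Function.Periodic.im_invQParam, abs_mul, abs_div, abs_neg, abs_one,
      abs_of_pos Real.two_pi_pos, one_div, inv_mul_lt_iff₀ Real.two_pi_pos]
    exact h
  have hVlog : ∀ z ∈ V, z ≠ 0 ∧ |Real.log ‖z‖| < 2 * π * δ := by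
    rintro _ ⟨w, hw, rfl⟩
    refine ⟨Function.Periodic.qParam_ne_zero w, ?_⟩
    rw [Function.Periodic.norm_qParam, Real.log_exp, div_one, abs_mul, neg_mul, abs_neg,
      abs_of_pos Real.two_pi_pos]
    exact mul_lt_mul_of_pos_left hw Real.two_pi_pos
  have hVopen : IsOpen V := by
    have : V = {z : ℂ | Real.exp (-(2 * π * δ)) < ‖z‖} ∩ {z : ℂ | ‖z‖ < Real.exp (2 * π * δ)} := by
      ext z
      constructor
      · intro h
        obtain ⟨h0, h1⟩ := hVlog z h
        have hp : 0 < ‖z‖ := norm_pos_iff.2 h0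
        rw [abs_lt] at h1
        exact ⟨(Real.lt_log_iff_exp_lt hp).1 h1.1, (Real.log_lt_iff_lt_exp hp).1 h1.2⟩
      · rintro ⟨h1, h2⟩
        have hp : 0 < ‖z‖ := (Real.exp_pos _).trans h1
        exact hVmem z (norm_pos_iff.1 hp)
          (abs_lt.2 ⟨(Real.lt_log_iff_exp_lt hp).2 h1, (Real.log_lt_iff_lt_exp hp).2 h2⟩)
    rw [this]
    exact (isOpen_lt continuous_const continuous_norm).inter
      (isOpen_lt continuous_norm continuous_const)
  have hVconn : IsPreconnected V :=
    (isPreconnected_strip δ).image _ Function.Periodic.differentiable_qParam.continuous.continuousOn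
  have hGdiff : DifferentiableOn ℂ G V := by
    rintro _ ⟨w, hw, rfl⟩
    exact (Function.Periodic.differentiableAt_cuspFunction one_ne_zero hper'
      ((hF w hw).differentiableAt ((isOpen_strip δ).mem_nhds hw))).differentiableWithinAt
  have hGan : AnalyticOnNhd ℂ G V := hGdiff.analyticOnNhd hVopen
  have hGord : ∀ u ∈ V, meromorphicOrderAt G u ≠ ⊤ := by
    intro u hu h
    rw [(hGan u hu).meromorphicOrderAt_eq] at h
    have h' : analyticOrderAt G u = ⊤ := by simpa using h
    rw [analyticOrderAt_eq_top] at h'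
    have := hGan.eqOn_zero_of_preconnected_of_eventuallyEq_zero hVconn hu h'
    obtain ⟨z, hz, hz0⟩ := hne
    exact hz0 (by rw [← hGF]; exact this (mem_image_of_mem _ hz))
  have hI : ∀ y : ℝ, ∫ x in (0 : ℝ)..1, Real.log ‖F (x + y * Complex.I)‖ =
      circleAverage (fun z => Real.log ‖G z‖) 0 (Real.exp (-2 * π * y)) := by
    intro y
    rw [← integral_line_eq_circleAverage]
    simp_rw [hGF]
  refine ⟨convex_Ioo _ _, fun y₁ h₁ y₂ h₂ p q hp hq hpq => ?_⟩
  -- A compact annulus containing both circles; compactness makes the divisor finite.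
  set m := max |y₁| |y₂| with hm
  have hmδ : m < δ := max_lt (abs_lt.2 h₁) (abs_lt.2 h₂)
  have hsub : annulus (-(2 * π * m)) (2 * π * m) ⊆ V := by
    intro z hz
    have hz0 := ne_zero_of_mem_annulus hz
    have hp : 0 < ‖z‖ := norm_pos_iff.2 hz0
    refine hVmem z hz0 (lt_of_le_of_lt (abs_le.2 ⟨?_, ?_⟩)
      (mul_lt_mul_of_pos_left hmδ Real.two_pi_pos))
    · exact (Real.le_log_iff_exp_le hp).2 hz.1
    · exact (Real.log_le_iff_le_exp hp).2 hz.2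
  have hconv := convexOn_circleAverage_log_norm (hGan.mono hsub) fun u hu => hGord u (hsub hu)
  have hmem : ∀ y : ℝ, |y| ≤ m → -2 * π * y ∈ Icc (-(2 * π * m)) (2 * π * m) := by
    intro y hy
    rw [mem_Icc, ← abs_le, abs_mul, neg_mul, abs_neg, abs_of_pos Real.two_pi_pos]
    exact mul_le_mul_of_nonneg_left hy Real.two_pi_pos.le
  have := hconv.2 (hmem y₁ (le_max_left _ _)) (hmem y₂ (le_max_right _ _)) hp hq hpq
  simp only [hI]
  convert this using 4
  simp only [smul_eq_mul]
  ring

/-! ### Holomorphic extension of periodic real analytic functions -/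

/-- A `1`-periodic real analytic function extends to a `1`-periodic holomorphic function on a
horizontal strip. -/
theorem IsAnalyticOnCircle.exists_extension {h : ℝ → ℝ} (hh : IsAnalyticOnCircle h) :
    ∃ δ : ℝ, 0 < δ ∧ ∃ H : ℂ → ℂ, Function.Periodic H 1 ∧ DifferentiableOn ℂ H (strip δ) ∧
      ∀ x : ℝ, H x = h x := by
  -- Taylor series based at `z.re`, evaluated at `z`. This global formula makes periodicity and
  -- agreement with `h` immediate and leaves no local extensions to glue.
  set H : ℂ → ℂ := fun z => ∑' n : ℕ, (n.factorial : ℂ)⁻¹ * ((iteratedDeriv n h z.re : ℝ) : ℂ) *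
    (z.im * Complex.I) ^ n with hH
  have hdiff : ∀ (n : ℕ) (x : ℝ), DifferentiableAt ℝ (iteratedDeriv n h) x := by
    intro n x
    have : ContDiff ℝ ⊤ h := by
      rw [← contDiffOn_univ]; exact hh.1.contDiffOn uniqueDiffOn_univ
    exact (this.differentiable_iteratedDeriv n (by exact WithTop.coe_lt_top _)) x
  have hper : Function.Periodic H 1 := by
    intro z
    have : ∀ n, iteratedDeriv n h (z.re + 1) = iteratedDeriv n h z.re := by
      intro n
      have h1 := congrFun (iteratedDeriv_comp_add_const n h 1) z.re
      rw [← h1]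
      congr 1
      exact funext hh.2
    simp [hH, this]
  have hreal : ∀ x : ℝ, H x = h x := by
    intro x
    simp only [hH, Complex.ofReal_re, Complex.ofReal_im, Complex.ofReal_zero, zero_mul]
    rw [tsum_eq_single 0 (by intro n hn; simp [hn])]
    simp
  have hlocal : ∀ x₀ : ℝ, AnalyticAt ℂ H x₀ := by
    intro x₀
    obtain ⟨p, r, hp⟩ := hh.1 x₀ (mem_univ _)
    obtain ⟨R, hR0, hRr⟩ := ENNReal.lt_iff_exists_nnreal_btwn.1 hp.r_pos
    have hR0' : 0 < (R : ℝ) := by exact_mod_cast hR0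
    obtain ⟨C, hC, hCb⟩ := p.norm_mul_pow_le_of_lt_radius (hRr.trans_le hp.r_le)
    -- Half the radius, so that the terms of the local series are at most `C / 2 ^ n`.
    set s : ℝ := R / 2 with hs
    have hs0 : 0 < s := by positivity
    set G : ℂ → ℂ := fun z => ∑' n : ℕ, (p.coeff n : ℂ) * (z - x₀) ^ n with hG
    have hcoef : ∀ n, |p.coeff n| ≤ C / (R : ℝ) ^ n := by
      intro n
      rw [le_div_iff₀ (by positivity), ← Real.norm_eq_abs, ← FormalMultilinearSeries.norm_apply_eq_norm_coef]
      exact hCb n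
    have hGd : DifferentiableOn ℂ G (ball (x₀ : ℂ) s) := by
      refine differentiableOn_tsum_of_summable_norm (u := fun n => C * (1 / 2) ^ n)
        ((summable_geometric_of_lt_one (by norm_num) (by norm_num)).mul_left C)
        (fun n => by fun_prop) isOpen_ball fun n z hz => ?_
      rw [mem_ball_iff_norm] at hz
      rw [norm_mul, norm_pow, Complex.norm_real, Real.norm_eq_abs]
      calc |p.coeff n| * ‖z - x₀‖ ^ n ≤ C / (R : ℝ) ^ n * s ^ n := by
            gcongr
            exact hcoef n
        _ = C * (1 / 2) ^ n := by
            rw [hs, div_mul_eq_mul_div, mul_div_assoc, ← div_pow]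
            congr 2
            field_simp
    have hGreal : ∀ x : ℝ, |x - x₀| < s → G x = h x := by
      intro x hx
      have hmem : x - x₀ ∈ eball (0 : ℝ) r := by
        rw [mem_eball, edist_zero_right]
        refine lt_trans ?_ hRr
        rw [← ofReal_norm, ENNReal.ofReal_lt_coe_iff (norm_nonneg _), Real.norm_eq_abs]
        linarith
      have h1 := hp.hasSum hmem
      simp only [FormalMultilinearSeries.apply_eq_pow_smul_coeff, smul_eq_mul,
        add_sub_cancel] at h1
      have h2 := (Complex.hasSum_ofReal.2 h1).tsum_eq
      rw [← h2, hG]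
      refine tsum_congr fun n => ?_
      push_cast
      ring
    have hGan : AnalyticOnNhd ℂ G (ball (x₀ : ℂ) s) := hGd.analyticOnNhd isOpen_ball
    -- At real points the complex derivatives of `G` are the real ones of `h`, so the Taylor series
    -- of `G` about `z.re` is the series defining `H`.
    have hiter : ∀ (n : ℕ) (x : ℝ), |x - x₀| < s →
        iteratedDeriv n G x = ((iteratedDeriv n h x : ℝ) : ℂ) := by
      intro n
      induction n with
      | zero => simpa using hGreal
      | succ n ih =>
        intro x hx
        have hxball : (x : ℂ) ∈ ball (x₀ : ℂ) s := by
          rw [mem_ball_iff_norm, ← Complex.ofReal_sub, Complex.norm_real, Real.norm_eq_abs]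
          exact hx
        rw [iteratedDeriv_succ, iteratedDeriv_succ]
        have hA : DifferentiableAt ℂ (iteratedDeriv n G) x := by
          have := (hGan.iterated_deriv n) x hxball
          rw [← iteratedDeriv_eq_iterate] at this
          exact this.differentiableAt
        have hev : (fun t : ℝ => iteratedDeriv n G t) =ᶠ[𝓝 x]
            fun t => ((iteratedDeriv n h t : ℝ) : ℂ) := by
          have : ∀ᶠ t : ℝ in 𝓝 x, |t - x₀| < s :=
            (isOpen_lt (by fun_prop) continuous_const).mem_nhds hx
          filter_upwards [this] with t ht using ih t ht
        have h1 := (hA.hasDerivAt.comp_ofReal).congr_of_eventuallyEq hev.symm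
        exact h1.unique (hdiff n x).hasDerivAt.ofReal_comp
    have hHG : EqOn H G (ball (x₀ : ℂ) (s / 2)) := by
      intro z hz
      rw [mem_ball_iff_norm] at hz
      have hre : |z.re - x₀| < s / 2 := by
        have := Complex.abs_re_le_norm (z - x₀)
        simp only [Complex.sub_re, Complex.ofReal_re] at this
        linarith
      have him : |z.im| < s / 2 := by
        have := Complex.abs_im_le_norm (z - x₀)
        simp only [Complex.sub_im, Complex.ofReal_im, sub_zero] at this
        linarith
      have hzz : z - z.re = z.im * Complex.I := by
        apply Complex.ext <;> simp
      have hsub : ball (z.re : ℂ) (s / 2) ⊆ ball (x₀ : ℂ) s := by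
        refine ball_subset_ball' ?_
        rw [dist_eq_norm, ← Complex.ofReal_sub, Complex.norm_real, Real.norm_eq_abs]
        linarith
      have hzmem : z ∈ ball (z.re : ℂ) (s / 2) := by
        rw [mem_ball_iff_norm, hzz]
        simpa using him
      rw [← Complex.taylorSeries_eq_on_ball' hzmem (hGd.mono hsub), hzz, hH]
      simp only [hiter _ z.re (by linarith)]
    refine ((hGan x₀ (mem_ball_self hs0))).congr ?_
    filter_upwards [ball_mem_nhds (x₀ : ℂ) (half_pos hs0)] with z hz using (hHG hz).symm
  -- Compactness gives one width over `[0, 1]`; translating by `⌊z.re⌋` covers the whole strip.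
  obtain ⟨δ, hδ, hsub⟩ := (isCompact_Icc (a := (0 : ℝ)) (b := 1)).image
    Complex.continuous_ofReal |>.exists_thickening_subset_open (isOpen_analyticAt ℂ H)
    (by rintro _ ⟨x, -, rfl⟩; exact hlocal x)
  refine ⟨δ, hδ, H, hper, fun z hz => ?_, hreal⟩
  set m : ℤ := ⌊z.re⌋ with hm
  have hz' : z - m ∈ thickening δ ((fun x : ℝ => (x : ℂ)) '' Icc 0 1) := by
    rw [mem_thickening_iff]
    refine ⟨((Int.fract z.re : ℝ) : ℂ), ⟨_, ⟨Int.fract_nonneg _, (Int.fract_lt_one _).le⟩, rfl⟩, ?_⟩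
    have : z - m - ((Int.fract z.re : ℝ) : ℂ) = z.im * Complex.I := by
      apply Complex.ext
      · simp only [Complex.sub_re, Complex.intCast_re, Complex.ofReal_re, ← Int.self_sub_floor, hm]
        simp
      · simp
    rw [dist_eq_norm, this]
    simpa using mem_strip.1 hz
  have h1 : AnalyticAt ℂ H (z - m) := hsub hz'
  have h2 : DifferentiableAt ℂ (fun w => H (w - m)) z :=
    DifferentiableAt.comp z (f := fun w : ℂ => w - m) h1.differentiableAt (by fun_prop)
  have h3 : (fun w => H (w - m)) = H := by
    ext w
    simpa using hper.sub_int_mul_eq m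
  rw [h3] at h2
  exact h2.differentiableWithinAt

/-! ### Determinants of nearly diagonal matrices -/

theorem norm_multiset_prod_bounds {a b : ℝ} (ha : 0 ≤ a) (s : Multiset ℂ)
    (hs : ∀ μ ∈ s, a ≤ ‖μ‖ ∧ ‖μ‖ ≤ b) :
    a ^ Multiset.card s ≤ ‖s.prod‖ ∧ ‖s.prod‖ ≤ b ^ Multiset.card s := by
  induction s using Multiset.induction_on with
  | empty => simp
  | cons μ s ih =>
    obtain ⟨h1, h2⟩ := hs μ (Multiset.mem_cons_self _ _)
    obtain ⟨h3, h4⟩ := ih fun ν hν => hs ν (Multiset.mem_cons_of_mem hν)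
    have hb : 0 ≤ b := (norm_nonneg μ).trans h2
    rw [Multiset.prod_cons, Multiset.card_cons, norm_mul, pow_succ', pow_succ']
    exact ⟨mul_le_mul h1 h3 (by positivity) (by positivity),
      mul_le_mul h2 h4 (by positivity) hb⟩

/-- A matrix whose rows are `η`-close to those of the identity in `ℓ¹` has determinant between
`(1 - η) ^ n` and `(1 + η) ^ n`. -/
theorem norm_det_bounds_of_near_one {n : Type*} [Fintype n] [DecidableEq n] {A : Matrix n n ℂ}
    {η : ℝ} (hη : η ≤ 1)
    (hA : ∀ i, ‖A i i - 1‖ + ∑ j ∈ Finset.univ.erase i, ‖A i j‖ ≤ η) :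
    (1 - η) ^ Fintype.card n ≤ ‖A.det‖ ∧ ‖A.det‖ ≤ (1 + η) ^ Fintype.card n := by
  have hcard : Multiset.card A.charpoly.roots = Fintype.card n := by
    rw [← (IsAlgClosed.splits A.charpoly).natDegree_eq_card_roots, Matrix.charpoly_natDegree_eq_dim]
  rw [Matrix.det_eq_prod_roots_charpoly, ← hcard]
  refine norm_multiset_prod_bounds (by linarith) _ fun μ hμ => ?_
  have hroot : Module.End.HasEigenvalue (Matrix.toLin' A) μ := by
    rw [Module.End.hasEigenvalue_iff_isRoot_charpoly, Matrix.charpoly_toLin']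
    exact (Polynomial.mem_roots'.1 hμ).2
  -- Gershgorin: every eigenvalue lies within `η` of `1`, and the determinant is their product.
  obtain ⟨k, hk⟩ := eigenvalue_mem_ball hroot
  rw [mem_closedBall_iff_norm] at hk
  have h1 : ‖μ - 1‖ ≤ η := by
    calc ‖μ - 1‖ = ‖(A k k - 1) + (μ - A k k)‖ := by congr 1; ring
      _ ≤ ‖A k k - 1‖ + ‖μ - A k k‖ := norm_add_le _ _
      _ ≤ _ := (by gcongr : _ ≤ ‖A k k - 1‖ + ∑ j ∈ Finset.univ.erase k, ‖A k j‖).trans (hA k)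
  have h2 := norm_sub_norm_le μ 1
  have h3 := norm_sub_norm_le 1 μ
  rw [norm_sub_rev] at h3
  rw [norm_one] at h2 h3
  constructor <;> linarith

/-- Determinant of a small row-wise perturbation of a diagonal matrix. -/
theorem abs_log_norm_det_sub_le {n : Type*} [Fintype n] [DecidableEq n] {M : Matrix n n ℂ}
    {d : n → ℂ} {c η : ℝ} (hc : 0 < c) (hη0 : 0 ≤ η) (hη : η ≤ 1 / 2) (hd : ∀ i, c ≤ ‖d i‖)
    (hM : ∀ i, ‖M i i - d i‖ + ∑ j ∈ Finset.univ.erase i, ‖M i j‖ ≤ η * c) :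
    M.det ≠ 0 ∧ |Real.log ‖M.det‖ - ∑ i, Real.log ‖d i‖| ≤ Fintype.card n * (2 * η) := by
  have hd0 : ∀ i, d i ≠ 0 := fun i => norm_pos_iff.1 (hc.trans_le (hd i))
  -- Dividing row `i` by `d i` reduces to a matrix near the identity.
  set A : Matrix n n ℂ := Matrix.of fun i j => (d i)⁻¹ * M i j with hAdef
  have hMA : M = Matrix.diagonal d * A := by
    ext i j
    simp [hAdef, Matrix.diagonal_mul, hd0 i]
  have hA : ∀ i, ‖A i i - 1‖ + ∑ j ∈ Finset.univ.erase i, ‖A i j‖ ≤ η := by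
    intro i
    have h1 : A i i - 1 = (d i)⁻¹ * (M i i - d i) := by
      simp [hAdef, mul_sub, hd0 i]
    rw [h1]
    simp only [hAdef, Matrix.of_apply, norm_mul, ← Finset.mul_sum, ← mul_add, norm_inv]
    rw [inv_mul_le_iff₀ (hc.trans_le (hd i))]
    calc _ ≤ η * c := hM i
      _ ≤ η * ‖d i‖ := by gcongr; exact hd i
      _ = _ := mul_comm _ _
  obtain ⟨hlo, hup⟩ := norm_det_bounds_of_near_one (by linarith) hA
  have hpos : 0 < ‖A.det‖ := (pow_pos (by linarith) _).trans_le hlo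
  have hdet : M.det = (∏ i, d i) * A.det := by rw [hMA, Matrix.det_mul, Matrix.det_diagonal]
  have hprod : (∏ i, d i) ≠ 0 := Finset.prod_ne_zero_iff.2 fun i _ => hd0 i
  refine ⟨by rw [hdet]; exact mul_ne_zero hprod (norm_pos_iff.1 hpos), ?_⟩
  have hlog : Real.log ‖M.det‖ - ∑ i, Real.log ‖d i‖ = Real.log ‖A.det‖ := by
    rw [hdet, norm_mul, Real.log_mul (norm_ne_zero_iff.2 hprod) hpos.ne', norm_prod,
      Real.log_prod fun i _ => norm_ne_zero_iff.2 (hd0 i)]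
    ring
  rw [hlog, abs_le]
  constructor
  · have h1 := Real.log_le_log (pow_pos (by linarith) _) hlo
    rw [Real.log_pow] at h1
    have h2 : -(2 * η) ≤ Real.log (1 - η) := by
      have h3 := Real.one_sub_inv_le_log_of_pos (x := 1 - η) (by linarith)
      refine le_trans ?_ h3
      have h4 : (1 - η)⁻¹ ≤ 1 + 2 * η := by
        rw [inv_le_iff_one_le_mul₀ (by linarith)]
        nlinarith
      linarith
    calc -(Fintype.card n * (2 * η)) = Fintype.card n * (-(2 * η)) := by ring
      _ ≤ Fintype.card n * Real.log (1 - η) := by gcongr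
      _ ≤ _ := h1
  · have h1 := Real.log_le_log hpos hup
    rw [Real.log_pow] at h1
    refine h1.trans ?_
    gcongr
    have := Real.log_le_sub_one_of_pos (x := 1 + η) (by linarith)
    linarith

/-! ### Logarithmic means and zeros along horizontal lines -/

/-- Upper semicontinuity of the logarithmic mean under uniform convergence. -/
theorem exists_integral_log_norm_le_add {h₀ : ℝ → ℂ} (hcont : Continuous h₀)
    (hint : IntervalIntegrable (fun x => Real.log ‖h₀ x‖) volume 0 1)
    (hne : ∀ᵐ x : ℝ, h₀ x ≠ 0) {κ : ℝ} (hκ : 0 < κ) :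
    ∃ s : ℝ, 0 < s ∧ ∀ h : ℝ → ℂ, IntervalIntegrable (fun x => Real.log ‖h x‖) volume 0 1 →
      (∀ᵐ x : ℝ, h x ≠ 0) → (∀ x ∈ Icc (0 : ℝ) 1, ‖h x - h₀ x‖ ≤ s) →
      ∫ x in (0 : ℝ)..1, Real.log ‖h x‖ ≤ (∫ x in (0 : ℝ)..1, Real.log ‖h₀ x‖) + κ := by
  obtain ⟨M, hM⟩ := (isCompact_Icc (a := (0 : ℝ)) (b := 1)).exists_bound_of_continuousOn
    hcont.continuousOn
  have hM0 : 0 ≤ M := (norm_nonneg _).trans (hM 0 ⟨le_rfl, zero_le_one⟩)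
  have hcs : ∀ s : ℝ, 0 < s → Continuous fun x => Real.log (‖h₀ x‖ + s) := fun s hs =>
    (hcont.norm.add_const s).log fun x => by positivity
  -- For `s < 1` the integrand lies between `log ‖h₀‖`, which is integrable, and `log (M + 1)`, so
  -- dominated convergence applies.
  have htend : Tendsto (fun s => ∫ x in (0 : ℝ)..1, Real.log (‖h₀ x‖ + s)) (𝓝[>] 0)
      (𝓝 (∫ x in (0 : ℝ)..1, Real.log ‖h₀ x‖)) := by
    refine intervalIntegral.tendsto_integral_filter_of_dominated_convergence
      (fun x => |Real.log ‖h₀ x‖| + Real.log (M + 1)) ?_ ?_ ?_ ?_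
    · filter_upwards [self_mem_nhdsWithin] with s hs
      exact (hcs s hs).aestronglyMeasurable
    · filter_upwards [self_mem_nhdsWithin, mem_nhdsWithin_of_mem_nhds (Iio_mem_nhds zero_lt_one)]
        with s hs hs1
      filter_upwards [hne] with x hx hx01
      rw [uIoc_of_le zero_le_one] at hx01
      have hpos : 0 < ‖h₀ x‖ := norm_pos_iff.2 hx
      have hs0 : 0 < s := hs
      have hs1' : s < 1 := hs1
      have h1 : Real.log ‖h₀ x‖ ≤ Real.log (‖h₀ x‖ + s) := Real.log_le_log hpos (by linarith)
      have h2 : Real.log (‖h₀ x‖ + s) ≤ Real.log (M + 1) :=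
        Real.log_le_log (by linarith) (by linarith [hM x ⟨hx01.1.le, hx01.2⟩])
      have h3 : 0 ≤ Real.log (M + 1) := Real.log_nonneg (by linarith)
      rw [Real.norm_eq_abs, abs_le]
      constructor
      · linarith [neg_abs_le (Real.log ‖h₀ x‖)]
      · linarith [abs_nonneg (Real.log ‖h₀ x‖)]
    · exact hint.abs.add intervalIntegrable_const
    · filter_upwards [hne] with x hx _
      have hpos : 0 < ‖h₀ x‖ := norm_pos_iff.2 hx
      have : ContinuousAt (fun s => Real.log (‖h₀ x‖ + s)) 0 :=
        ContinuousAt.log (by fun_prop) (by simpa using hx)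
      simpa using this.tendsto.mono_left nhdsWithin_le_nhds
  obtain ⟨s, hlt, hs⟩ := ((htend.eventually (gt_mem_nhds (lt_add_of_pos_right _ hκ))).and
    self_mem_nhdsWithin).exists
  refine ⟨s, hs, fun h hhint hhne hclose => le_trans ?_ hlt.le⟩
  refine intervalIntegral.integral_mono_ae_restrict zero_le_one hhint
    ((hcs s hs).intervalIntegrable _ _) ?_
  rw [EventuallyLE, ae_restrict_iff' measurableSet_Icc]
  filter_upwards [hhne] with x hx hx01
  refine Real.log_le_log (norm_pos_iff.2 hx) ?_
  have := norm_sub_norm_le (h x) (h₀ x)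
  linarith [hclose x hx01]

theorem line_add (x y t : ℝ) :
    (x + y * Complex.I + t : ℂ) = ((x + t : ℝ) : ℂ) + y * Complex.I := by
  push_cast; ring

theorem periodic_line {α : Type*} {H : ℂ → α} (hper : Function.Periodic H 1) (y : ℝ) :
    Function.Periodic (fun x : ℝ => H (x + y * Complex.I)) 1 := by
  intro x
  have := hper (x + y * Complex.I)
  simp only [Complex.ofReal_add, Complex.ofReal_one]
  rw [← this]
  congr 1
  ring

theorem continuous_line {δ : ℝ} {H : ℂ → ℂ} (hH : DifferentiableOn ℂ H (strip δ)) {y : ℝ}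
    (hy : |y| < δ) : Continuous fun x : ℝ => H (x + y * Complex.I) :=
  hH.continuousOn.comp_continuous (by fun_prop) fun x => line_mem_strip hy x

theorem exists_norm_le_line {δ : ℝ} {H : ℂ → ℂ} (hper : Function.Periodic H 1)
    (hH : DifferentiableOn ℂ H (strip δ)) {y : ℝ} (hy : |y| < δ) :
    ∃ M : ℝ, ∀ x : ℝ, ‖H (x + y * Complex.I)‖ ≤ M := by
  obtain ⟨M, hM⟩ := (isCompact_Icc (a := (0 : ℝ)) (b := 1)).exists_bound_of_continuousOn
    (continuous_line hH hy).continuousOn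
  refine ⟨M, fun x => ?_⟩
  obtain ⟨x', hx', hxx'⟩ := (periodic_line hper y).exists_mem_Ico₀ zero_lt_one x
  rw [hxx']
  exact hM x' ⟨hx'.1, hx'.2.le⟩

theorem exists_le_norm_line {δ : ℝ} {H : ℂ → ℂ} (hper : Function.Periodic H 1)
    (hH : DifferentiableOn ℂ H (strip δ)) {y : ℝ} (hy : |y| < δ)
    (hne : ∀ x : ℝ, x ∈ Icc (0 : ℝ) 1 → H (x + y * Complex.I) ≠ 0) :
    ∃ c : ℝ, 0 < c ∧ ∀ x : ℝ, c ≤ ‖H (x + y * Complex.I)‖ := by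
  obtain ⟨x₀, hx₀, hmin⟩ := (isCompact_Icc (a := (0 : ℝ)) (b := 1)).exists_isMinOn
    ⟨0, le_rfl, zero_le_one⟩ (continuous_line hH hy).norm.continuousOn
  refine ⟨_, norm_pos_iff.2 (hne x₀ hx₀), fun x => ?_⟩
  obtain ⟨x', hx', hxx'⟩ := (periodic_line hper y).exists_mem_Ico₀ zero_lt_one x
  rw [hxx']
  exact hmin ⟨hx'.1, hx'.2.le⟩

/-- A nonzero holomorphic function on a strip has no zeros on horizontal lines slightly above
`[0, 1]`. -/
theorem eventually_forall_line_ne_zero {δ : ℝ} (hδ : 0 < δ) {H : ℂ → ℂ}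
    (hH : DifferentiableOn ℂ H (strip δ)) (hne : ∃ z ∈ strip δ, H z ≠ 0) :
    ∀ᶠ y : ℝ in 𝓝[>] (0 : ℝ), ∀ x : ℝ, x ∈ Icc (0 : ℝ) 1 → H (x + y * Complex.I) ≠ 0 := by
  -- Zeros are isolated, and `y > 0` excludes the centre `x` itself, which may be a zero.
  -- Compactness of `[0, 1]` then gives a common range of heights.
  have hpt : ∀ x ∈ Icc (0 : ℝ) 1, ∀ᶠ p : ℝ × ℝ in 𝓝 ((0 : ℝ), x),
      p.1 ∈ Ioi (0 : ℝ) → H (p.2 + p.1 * Complex.I) ≠ 0 := by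
    intro x _
    have hA := hH.analyticOnNhd (isOpen_strip δ)
    have hx : (x : ℂ) ∈ strip δ := by simpa [mem_strip] using hδ
    have hev : ∀ᶠ z in 𝓝[≠] (x : ℂ), H z ≠ 0 := by
      refine (hA x hx).eventually_eq_zero_or_eventually_ne_zero.resolve_left fun h0 => ?_
      obtain ⟨z, hz, hz0⟩ := hne
      exact hz0 (hA.eqOn_zero_of_preconnected_of_eventuallyEq_zero (isPreconnected_strip δ) hx h0 hz)
    rw [eventually_nhdsWithin_iff] at hev
    have hc : Continuous fun p : ℝ × ℝ => (p.2 + p.1 * Complex.I : ℂ) := by fun_prop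
    have ht := hc.tendsto ((0 : ℝ), x)
    simp only [Complex.ofReal_zero, zero_mul, add_zero] at ht
    filter_upwards [ht.eventually hev] with p hp hp1
    refine hp fun heq => ?_
    have him := congrArg Complex.im heq
    simp only [Complex.add_im, Complex.ofReal_im, Complex.mul_im, Complex.ofReal_re, Complex.I_im,
      Complex.I_re] at him
    have : p.1 = 0 := by linarith
    exact absurd this (ne_of_gt hp1)
  rw [eventually_nhdsWithin_iff]
  have := isCompact_Icc.eventually_forall_of_forall_eventually
    (P := fun y x : ℝ => y ∈ Ioi (0 : ℝ) → H (x + y * Complex.I) ≠ 0) hpt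
  filter_upwards [this] with y hy hy0 x hx using hy x hx hy0

theorem analyticAt_ofReal_of_differentiableOn_strip {δ : ℝ} (hδ : 0 < δ) {H : ℂ → ℂ}
    (hH : DifferentiableOn ℂ H (strip δ)) (x : ℝ) : AnalyticAt ℝ (fun x : ℝ => H x) x := by
  have hx : (x : ℂ) ∈ strip δ := by simpa [mem_strip] using hδ
  exact ((hH.analyticOnNhd (isOpen_strip δ) x hx).restrictScalars (𝕜 := ℝ)).comp
    (Complex.ofRealCLM.analyticAt x)

theorem intervalIntegrable_log_norm_ofReal {δ : ℝ} (hδ : 0 < δ) {H : ℂ → ℂ}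
    (hH : DifferentiableOn ℂ H (strip δ)) :
    IntervalIntegrable (fun x : ℝ => Real.log ‖H x‖) volume 0 1 :=
  MeromorphicOn.intervalIntegrable_log_norm (f := fun x : ℝ => H x) fun x _ =>
    (analyticAt_ofReal_of_differentiableOn_strip hδ hH x).meromorphicAt

theorem ae_ne_zero_ofReal {δ : ℝ} (hδ : 0 < δ) {H : ℂ → ℂ}
    (hH : DifferentiableOn ℂ H (strip δ)) (hne : ∃ z ∈ strip δ, H z ≠ 0) :
    ∀ᵐ x : ℝ, H x ≠ 0 := by
  have hA := hH.analyticOnNhd (isOpen_strip δ)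
  have hev : ∀ x : ℝ, ∀ᶠ t : ℝ in 𝓝[≠] x, H t ≠ 0 := by
    intro x
    have hx : (x : ℂ) ∈ strip δ := by simpa [mem_strip] using hδ
    have hev : ∀ᶠ z in 𝓝[≠] (x : ℂ), H z ≠ 0 := by
      refine (hA x hx).eventually_eq_zero_or_eventually_ne_zero.resolve_left fun h0 => ?_
      obtain ⟨z, hz, hz0⟩ := hne
      exact hz0 (hA.eqOn_zero_of_preconnected_of_eventuallyEq_zero (isPreconnected_strip δ) hx h0 hz)
    refine (tendsto_nhdsWithin_of_tendsto_nhds_of_eventually_within _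
      ((Complex.continuous_ofReal.tendsto x).mono_left nhdsWithin_le_nhds) ?_).eventually hev
    filter_upwards [self_mem_nhdsWithin] with t ht
    simpa using ht
  have hmem : {t : ℝ | H t ≠ 0} ∈ codiscreteWithin (univ : Set ℝ) := by
    rw [mem_codiscreteWithin]
    intro x _
    rw [Filter.disjoint_principal_right]
    filter_upwards [hev x] with t ht using fun h => h.2 ht
  have := ae_restrict_le_codiscreteWithin (μ := volume) MeasurableSet.univ hmem
  rwa [Measure.restrict_univ] at this

/-! ### The complexified matrix -/

/-- The combination `a G - b F`. -/
def combo (F G : ℂ → ℂ) (a b : ℝ) (z : ℂ) : ℂ := a * G z - b * F z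

/-- Holomorphic version of `matrixB`, with `(a, b)` in place of `(1, E) / √(1 + E²)`. -/
noncomputable def holMatrix (F G : ℂ → ℂ) (φ : ℝ → ℝ) (ε ω : ℝ) (N : ℕ) (a b : ℝ) (z : ℂ) :
    Matrix (Fin N) (Fin N) ℂ :=
  Matrix.of fun n n' =>
    if n = n' then combo F G a b (z + ((n : ℕ) * ω : ℝ))
    else (ε * a : ℝ) * F (z + ((n : ℕ) * ω : ℝ)) * fourierHat φ (((n : ℕ) : ℤ) - ((n' : ℕ) : ℤ))

theorem differentiableOn_combo {δ : ℝ} {F G : ℂ → ℂ} (hF : DifferentiableOn ℂ F (strip δ))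
    (hG : DifferentiableOn ℂ G (strip δ)) (a b : ℝ) :
    DifferentiableOn ℂ (combo F G a b) (strip δ) :=
  (hG.const_mul _).sub (hF.const_mul _)

theorem periodic_combo {F G : ℂ → ℂ} (hF : Function.Periodic F 1) (hG : Function.Periodic G 1)
    (a b : ℝ) : Function.Periodic (combo F G a b) 1 := fun z => by
  simp only [combo, hF z, hG z]

theorem differentiableOn_comp_add_ofReal {δ : ℝ} {H : ℂ → ℂ} (hH : DifferentiableOn ℂ H (strip δ))
    (t : ℝ) : DifferentiableOn ℂ (fun z => H (z + t)) (strip δ) := by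
  refine hH.comp (f := fun z : ℂ => z + t) (by fun_prop) fun z hz => ?_
  simpa [mem_strip] using mem_strip.1 hz

theorem differentiableOn_det_holMatrix {δ : ℝ} {F G : ℂ → ℂ} (hF : DifferentiableOn ℂ F (strip δ))
    (hG : DifferentiableOn ℂ G (strip δ)) (φ : ℝ → ℝ) (ε ω : ℝ) (N : ℕ) (a b : ℝ) :
    DifferentiableOn ℂ (fun z => (holMatrix F G φ ε ω N a b z).det) (strip δ) := by
  simp only [Matrix.det_apply]
  refine DifferentiableOn.fun_sum fun σ _ => DifferentiableOn.const_smul ?_ _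
  refine DifferentiableOn.fun_finsetProd fun i _ => ?_
  simp only [holMatrix, Matrix.of_apply]
  split_ifs
  · exact differentiableOn_comp_add_ofReal (differentiableOn_combo hF hG a b) _
  · exact ((differentiableOn_comp_add_ofReal hF _).const_mul _).mul_const _

theorem periodic_det_holMatrix {F G : ℂ → ℂ} (hF : Function.Periodic F 1)
    (hG : Function.Periodic G 1) (φ : ℝ → ℝ) (ε ω : ℝ) (N : ℕ) (a b : ℝ) :
    Function.Periodic (fun z => (holMatrix F G φ ε ω N a b z).det) 1 := by
  intro z
  have h : ∀ t : ℝ, z + 1 + (t : ℂ) = z + t + 1 := fun t => by ring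
  simp only [holMatrix, h, hF _, periodic_combo hF hG a b _]

/-- Exponential decay of the Fourier coefficients bounds the row sums of the convolution matrix. -/
theorem exists_sum_norm_fourierHat_le {φ : ℝ → ℝ}
    (hφ : ∃ ρ : ℝ, 0 < ρ ∧ ∀ n : ℤ, ‖fourierHat φ n‖ < Real.exp (-ρ * |(n : ℝ)|)) :
    ∃ S : ℝ, 0 ≤ S ∧ ∀ (N : ℕ) (i : Fin N) (s : Finset (Fin N)),
      ∑ j ∈ s, ‖fourierHat φ (((i : ℕ) : ℤ) - ((j : ℕ) : ℤ))‖ ≤ S := by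
  obtain ⟨ρ, hρ, hb⟩ := hφ
  have hsum : Summable fun n : ℤ => Real.exp (-ρ * |(n : ℝ)|) := by
    have hnat : Summable fun n : ℕ => Real.exp (-ρ * (n : ℝ)) := by
      have := Real.summable_exp_nat_mul_iff.2 (neg_lt_zero.2 hρ)
      simpa [mul_comm] using this
    refine Summable.of_nat_of_neg ?_ ?_ <;> simpa using hnat
  refine ⟨∑' n : ℤ, Real.exp (-ρ * |(n : ℝ)|), tsum_nonneg fun n => (Real.exp_pos _).le,
    fun N i s => ?_⟩
  have hinj : Set.InjOn (fun j : Fin N => ((i : ℕ) : ℤ) - ((j : ℕ) : ℤ)) s := by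
    intro j _ k _ h
    simp only at h
    exact Fin.ext (by omega)
  calc ∑ j ∈ s, ‖fourierHat φ (((i : ℕ) : ℤ) - ((j : ℕ) : ℤ))‖
      = ∑ n ∈ s.image (fun j : Fin N => ((i : ℕ) : ℤ) - ((j : ℕ) : ℤ)), ‖fourierHat φ n‖ :=
        (Finset.sum_image (f := fun n => ‖fourierHat φ n‖) hinj).symm
    _ ≤ ∑ n ∈ s.image (fun j : Fin N => ((i : ℕ) : ℤ) - ((j : ℕ) : ℤ)),
        Real.exp (-ρ * |(n : ℝ)|) := Finset.sum_le_sum fun n _ => (hb n).le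
    _ ≤ _ := hsum.sum_le_tsum _ fun n _ => (Real.exp_pos _).le

/-! ### The determinant estimate near a fixed parameter -/

/-- On a horizontal line along which `a₀ G - b₀ F` stays away from `0`, the logarithmic mean of
`det B` is `N` times that of `a₀ G - b₀ F`, up to a small error. -/
theorem abs_integral_log_norm_det_sub_le {δ y : ℝ} {F G : ℂ → ℂ} {φ : ℝ → ℝ}
    (hFp : Function.Periodic F 1) (hGp : Function.Periodic G 1)
    (hF : DifferentiableOn ℂ F (strip δ)) (hG : DifferentiableOn ℂ G (strip δ)) (hy : |y| < δ)
    {a₀ b₀ a b c M S s ε η : ℝ} (hc : 0 < c)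
    (hlow : ∀ x : ℝ, c ≤ ‖combo F G a₀ b₀ (x + y * Complex.I)‖)
    (hFM : ∀ x : ℝ, ‖F (x + y * Complex.I)‖ ≤ M) (hGM : ∀ x : ℝ, ‖G (x + y * Complex.I)‖ ≤ M)
    (hS : ∀ (N : ℕ) (i : Fin N) (s : Finset (Fin N)),
      ∑ j ∈ s, ‖fourierHat φ (((i : ℕ) : ℤ) - ((j : ℕ) : ℤ))‖ ≤ S)
    (has : |a - a₀| ≤ s) (hbs : |b - b₀| ≤ s) (ha1 : |a| ≤ 1) (hε : 0 ≤ ε) (hη0 : 0 ≤ η)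
    (hη : η ≤ 1 / 2) (hsmall : 2 * s * M + ε * M * S ≤ η * c) (ω : ℝ) (N : ℕ) :
    (∀ x : ℝ, (holMatrix F G φ ε ω N a b (x + y * Complex.I)).det ≠ 0) ∧
    |(∫ x in (0 : ℝ)..1, Real.log ‖(holMatrix F G φ ε ω N a b (x + y * Complex.I)).det‖)
      - N * ∫ x in (0 : ℝ)..1, Real.log ‖combo F G a₀ b₀ (x + y * Complex.I)‖|
      ≤ N * (2 * η) := by
  have hM0 : 0 ≤ M := (norm_nonneg _).trans (hFM 0)
  have hpt : ∀ x : ℝ, (holMatrix F G φ ε ω N a b (x + y * Complex.I)).det ≠ 0 ∧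
      |Real.log ‖(holMatrix F G φ ε ω N a b (x + y * Complex.I)).det‖
        - ∑ i : Fin N, Real.log ‖combo F G a₀ b₀ ((x + (i : ℕ) * ω : ℝ) + y * Complex.I)‖|
      ≤ N * (2 * η) := by
    intro x
    have := abs_log_norm_det_sub_le (M := holMatrix F G φ ε ω N a b (x + y * Complex.I))
      (d := fun i : Fin N => combo F G a₀ b₀ ((x + (i : ℕ) * ω : ℝ) + y * Complex.I))
      hc hη0 hη (fun i => hlow _) fun i => ?_
    · simpa only [Fintype.card_fin] using this
    have hline := line_add x y ((i : ℕ) * ω)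
    have h1 : ‖holMatrix F G φ ε ω N a b (x + y * Complex.I) i i
        - combo F G a₀ b₀ ((x + (i : ℕ) * ω : ℝ) + y * Complex.I)‖ ≤ 2 * s * M := by
      simp only [holMatrix, Matrix.of_apply, if_true, hline, combo]
      set w : ℂ := ((x + (i : ℕ) * ω : ℝ) + y * Complex.I) with hw
      have heq : (a : ℂ) * G w - b * F w - (a₀ * G w - b₀ * F w) =
          ((a - a₀ : ℝ) : ℂ) * G w - ((b - b₀ : ℝ) : ℂ) * F w := by push_cast; ring
      rw [heq]
      refine (norm_sub_le _ _).trans ?_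
      rw [norm_mul, norm_mul, Complex.norm_real, Complex.norm_real, Real.norm_eq_abs,
        Real.norm_eq_abs]
      have := mul_le_mul has (hGM (x + (i : ℕ) * ω)) (norm_nonneg _) ((abs_nonneg _).trans has)
      have := mul_le_mul hbs (hFM (x + (i : ℕ) * ω)) (norm_nonneg _) ((abs_nonneg _).trans hbs)
      linarith
    have h2 : ∑ j ∈ Finset.univ.erase i, ‖holMatrix F G φ ε ω N a b (x + y * Complex.I) i j‖
        ≤ ε * M * S := by
      calc _ ≤ ∑ j ∈ Finset.univ.erase i,
            ε * M * ‖fourierHat φ (((i : ℕ) : ℤ) - ((j : ℕ) : ℤ))‖ := by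
            refine Finset.sum_le_sum fun j hj => ?_
            simp only [holMatrix, Matrix.of_apply, if_neg (Finset.ne_of_mem_erase hj).symm, hline]
            rw [norm_mul, norm_mul, Complex.norm_real, Real.norm_eq_abs, abs_mul, abs_of_nonneg hε]
            have h3 : ε * |a| ≤ ε := mul_le_of_le_one_right hε ha1
            gcongr
            exact hFM _
        _ ≤ ε * M * S := by
            rw [← Finset.mul_sum]
            exact mul_le_mul_of_nonneg_left (hS N i _) (by positivity)
    linarith
  refine ⟨fun x => (hpt x).1, ?_⟩
  have hdetc : Continuous fun x : ℝ => (holMatrix F G φ ε ω N a b (x + y * Complex.I)).det :=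
    continuous_line (differentiableOn_det_holMatrix hF hG φ ε ω N a b) hy
  have hlogdet : Continuous fun x : ℝ =>
      Real.log ‖(holMatrix F G φ ε ω N a b (x + y * Complex.I)).det‖ :=
    hdetc.norm.log fun x => norm_ne_zero_iff.2 (hpt x).1
  have hlog0 : Continuous fun x : ℝ => Real.log ‖combo F G a₀ b₀ (x + y * Complex.I)‖ :=
    (continuous_line (differentiableOn_combo hF hG a₀ b₀) hy).norm.log
      fun x => (hc.trans_le (hlow x)).ne'
  have hlogsh : ∀ t : ℝ, Continuous fun x : ℝ =>
      Real.log ‖combo F G a₀ b₀ ((x + t : ℝ) + y * Complex.I)‖ := fun t =>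
    hlog0.comp (continuous_add_const t)
  -- By periodicity all `N` translates have the same mean, whatever `ω` is.
  have hshift : ∀ t : ℝ, ∫ x in (0 : ℝ)..1,
      Real.log ‖combo F G a₀ b₀ ((x + t : ℝ) + y * Complex.I)‖ =
      ∫ x in (0 : ℝ)..1, Real.log ‖combo F G a₀ b₀ (x + y * Complex.I)‖ := by
    intro t
    rw [intervalIntegral.integral_comp_add_right
      (fun x : ℝ => Real.log ‖combo F G a₀ b₀ (x + y * Complex.I)‖) t]
    have hp : Function.Periodic
        (fun x : ℝ => Real.log ‖combo F G a₀ b₀ (x + y * Complex.I)‖) 1 :=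
      (periodic_line (periodic_combo hFp hGp a₀ b₀) y).comp fun w => Real.log ‖w‖
    simpa [add_comm] using hp.intervalIntegral_add_eq t 0
  have hN : N * ∫ x in (0 : ℝ)..1, Real.log ‖combo F G a₀ b₀ (x + y * Complex.I)‖ =
      ∫ x in (0 : ℝ)..1, ∑ i : Fin N,
        Real.log ‖combo F G a₀ b₀ ((x + (i : ℕ) * ω : ℝ) + y * Complex.I)‖ := by
    rw [intervalIntegral.integral_finsetSum fun i _ => (hlogsh _).intervalIntegrable _ _]
    simp only [hshift, Finset.sum_const, Finset.card_univ, Fintype.card_fin, nsmul_eq_mul]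
  rw [hN, ← intervalIntegral.integral_sub (hlogdet.intervalIntegrable _ _)
    ((continuous_finsetSum _ fun i _ => hlogsh _).intervalIntegrable _ _)]
  have := intervalIntegral.norm_integral_le_of_norm_le_const (a := (0 : ℝ)) (b := 1)
    (f := fun x : ℝ => Real.log ‖(holMatrix F G φ ε ω N a b (x + y * Complex.I)).det‖
      - ∑ i : Fin N, Real.log ‖combo F G a₀ b₀ ((x + (i : ℕ) * ω : ℝ) + y * Complex.I)‖)
    (C := N * (2 * η)) (fun x _ => (hpt x).2)
  simpa using this

/-- The mean `J` is convex on an open interval, hence continuous at `0`, so `2 J(y) - J(2y) → J(0)`.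
Lines slightly above the real axis carry no zeros, which supplies `c` at both heights. -/
theorem exists_height {δ : ℝ} (hδ : 0 < δ) {H : ℂ → ℂ} (hper : Function.Periodic H 1)
    (hH : DifferentiableOn ℂ H (strip δ)) (hne : ∃ z ∈ strip δ, H z ≠ 0) {κ : ℝ} (hκ : 0 < κ) :
    ∃ y c : ℝ, 0 < y ∧ 2 * y < δ ∧ 0 < c ∧
      (∀ x : ℝ, c ≤ ‖H (x + y * Complex.I)‖) ∧
      (∀ x : ℝ, c ≤ ‖H (x + (2 * y : ℝ) * Complex.I)‖) ∧
      (∫ x in (0 : ℝ)..1, Real.log ‖H x‖) - κ <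
        2 * (∫ x in (0 : ℝ)..1, Real.log ‖H (x + y * Complex.I)‖)
          - ∫ x in (0 : ℝ)..1, Real.log ‖H (x + (2 * y : ℝ) * Complex.I)‖ := by
  set J : ℝ → ℝ := fun y => ∫ x in (0 : ℝ)..1, Real.log ‖H (x + y * Complex.I)‖ with hJ
  have hJ0 : ∫ x in (0 : ℝ)..1, Real.log ‖H x‖ = J 0 := by simp [hJ]
  have hcont : ContinuousAt J 0 :=
    ((convexOn_integral_log_norm hper hH hne).continuousOn isOpen_Ioo).continuousAt
      (Ioo_mem_nhds (by linarith) hδ)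
  have hdbl : Tendsto (fun y : ℝ => 2 * y) (𝓝[>] 0) (𝓝[>] 0) := by
    refine tendsto_nhdsWithin_of_tendsto_nhds_of_eventually_within _ ?_ ?_
    · have : Tendsto (fun y : ℝ => 2 * y) (𝓝 0) (𝓝 (2 * 0)) :=
        (continuous_const_mul 2).tendsto 0
      rw [mul_zero] at this
      exact this.mono_left nhdsWithin_le_nhds
    · filter_upwards [self_mem_nhdsWithin] with y hy
      have : (0 : ℝ) < y := hy
      exact mul_pos two_pos this
  have ht1 : Tendsto J (𝓝[>] 0) (𝓝 (J 0)) := hcont.tendsto.mono_left nhdsWithin_le_nhds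
  have ht2 : Tendsto (fun y => 2 * J y - J (2 * y)) (𝓝[>] 0) (𝓝 (2 * J 0 - J 0)) :=
    (ht1.const_mul 2).sub (ht1.comp hdbl)
  have hz := eventually_forall_line_ne_zero hδ hH hne
  have hsm : ∀ᶠ y in 𝓝[>] (0 : ℝ), y < δ :=
    mem_nhdsWithin_of_mem_nhds (Iio_mem_nhds hδ)
  obtain ⟨y, hlt, hz1, hz2, hyδ, hy0⟩ := ((ht2.eventually (lt_mem_nhds
    (show J 0 - κ < 2 * J 0 - J 0 by linarith))).and (hz.and ((hdbl.eventually hz).and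
      ((hdbl.eventually hsm).and self_mem_nhdsWithin)))).exists
  have hy0' : 0 < y := hy0
  obtain ⟨c₁, hc₁, h1⟩ := exists_le_norm_line hper hH (y := y)
    (by rw [abs_of_pos hy0']; linarith) hz1
  obtain ⟨c₂, hc₂, h2⟩ := exists_le_norm_line hper hH (y := 2 * y)
    (by rw [abs_of_pos (by linarith)]; exact hyδ) hz2
  refine ⟨y, min c₁ c₂, hy0', hyδ, lt_min hc₁ hc₂, fun x => (min_le_left _ _).trans (h1 x),
    fun x => (min_le_right _ _).trans (h2 x), ?_⟩
  rw [hJ0]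
  exact hlt

/-- The determinant estimate, locally uniformly in the parameters `(a, b)`. -/
theorem exists_local_bound {δ : ℝ} (hδ : 0 < δ) {F G : ℂ → ℂ} {φ : ℝ → ℝ}
    (hFp : Function.Periodic F 1) (hGp : Function.Periodic G 1)
    (hF : DifferentiableOn ℂ F (strip δ)) (hG : DifferentiableOn ℂ G (strip δ))
    (hφ : ∃ ρ : ℝ, 0 < ρ ∧ ∀ n : ℤ, ‖fourierHat φ n‖ < Real.exp (-ρ * |(n : ℝ)|))
    {a₀ b₀ : ℝ} (hne : ∃ z ∈ strip δ, combo F G a₀ b₀ z ≠ 0) {κ : ℝ} (hκ : 0 < κ) :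
    ∃ ε₁ s : ℝ, 0 < ε₁ ∧ 0 < s ∧ ∀ a b ε : ℝ, |a - a₀| ≤ s → |b - b₀| ≤ s → |a| ≤ 1 →
      (∃ z ∈ strip δ, combo F G a b z ≠ 0) → 0 < ε → ε < ε₁ → ∀ (ω : ℝ) (N : ℕ), 0 < N →
      (∃ z ∈ strip δ, (holMatrix F G φ ε ω N a b z).det ≠ 0) ∧
      (∫ x in (0 : ℝ)..1, Real.log ‖combo F G a b x‖) - κ <
        (1 / (N : ℝ)) * ∫ x in (0 : ℝ)..1, Real.log ‖(holMatrix F G φ ε ω N a b x).det‖ := by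
  obtain ⟨S, hS0, hS⟩ := exists_sum_norm_fourierHat_le hφ
  have hH := differentiableOn_combo hF hG a₀ b₀
  have hHp := periodic_combo hFp hGp a₀ b₀
  obtain ⟨y, c, hy0, hyδ, hc, hlow1, hlow2, hgap⟩ :=
    exists_height hδ hHp hH hne (κ := κ / 4) (by positivity)
  have habs0 : |(0 : ℝ)| < δ := by simpa using hδ
  have habs1 : |y| < δ := by rw [abs_of_pos hy0]; linarith
  have habs2 : |2 * y| < δ := by rw [abs_of_pos (by linarith)]; exact hyδ
  have hbound : ∃ M : ℝ, 0 < M ∧ (∀ x : ℝ, ‖F x‖ ≤ M ∧ ‖G x‖ ≤ M) ∧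
      (∀ x : ℝ, ‖F (x + y * Complex.I)‖ ≤ M ∧ ‖G (x + y * Complex.I)‖ ≤ M) ∧
      (∀ x : ℝ, ‖F (x + (2 * y : ℝ) * Complex.I)‖ ≤ M ∧
        ‖G (x + (2 * y : ℝ) * Complex.I)‖ ≤ M) := by
    obtain ⟨A₀, hA₀⟩ := exists_norm_le_line hFp hF habs0
    obtain ⟨A₁, hA₁⟩ := exists_norm_le_line hFp hF habs1
    obtain ⟨A₂, hA₂⟩ := exists_norm_le_line hFp hF habs2
    obtain ⟨B₀, hB₀⟩ := exists_norm_le_line hGp hG habs0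
    obtain ⟨B₁, hB₁⟩ := exists_norm_le_line hGp hG habs1
    obtain ⟨B₂, hB₂⟩ := exists_norm_le_line hGp hG habs2
    simp only [Complex.ofReal_zero, zero_mul, add_zero] at hA₀ hB₀
    refine ⟨|A₀| + |A₁| + |A₂| + |B₀| + |B₁| + |B₂| + 1, by positivity, fun x => ?_, fun x => ?_,
      fun x => ?_⟩
    · constructor <;> linarith [hA₀ x, hB₀ x, le_abs_self A₀, le_abs_self B₀, abs_nonneg A₀,
        abs_nonneg A₁, abs_nonneg A₂, abs_nonneg B₀, abs_nonneg B₁, abs_nonneg B₂]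
    · constructor <;> linarith [hA₁ x, hB₁ x, le_abs_self A₁, le_abs_self B₁, abs_nonneg A₀,
        abs_nonneg A₁, abs_nonneg A₂, abs_nonneg B₀, abs_nonneg B₁, abs_nonneg B₂]
    · constructor <;> linarith [hA₂ x, hB₂ x, le_abs_self A₂, le_abs_self B₂, abs_nonneg A₀,
        abs_nonneg A₁, abs_nonneg A₂, abs_nonneg B₀, abs_nonneg B₁, abs_nonneg B₂]
  obtain ⟨M, hM, hM0, hM1, hM2⟩ := hbound
  have hcont0 : Continuous fun x : ℝ => combo F G a₀ b₀ x := by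
    simpa using continuous_line hH habs0
  obtain ⟨s₁, hs₁, husc⟩ := exists_integral_log_norm_le_add hcont0
    (intervalIntegrable_log_norm_ofReal hδ hH) (ae_ne_zero_ofReal hδ hH hne)
    (κ := κ / 4) (by positivity)
  -- The losses are `κ / 4` from the choice of height, `κ / 4` from semicontinuity, and `6η ≤ κ / 4`
  -- from the determinants.
  set η : ℝ := min (1 / 2) (κ / 24) with hη
  have hη0 : 0 < η := by rw [hη]; positivity
  have hη1 : η ≤ 1 / 2 := min_le_left _ _
  have hη2 : η ≤ κ / 24 := min_le_right _ _
  -- The first bound serves semicontinuity on the real line. The second spends half of the allowance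
  -- `η * c` on moving the parameters; the other half goes to the off-diagonal entries and fixes
  -- `ε₁`.
  set s : ℝ := min (s₁ / (2 * M)) (η * c / (4 * M)) with hs
  have hs0 : 0 < s := by rw [hs]; positivity
  have hsM1 : 2 * s * M ≤ s₁ := by
    have : s ≤ s₁ / (2 * M) := min_le_left _ _
    rw [le_div_iff₀ (by positivity)] at this
    linarith
  have hsM2 : 2 * s * M ≤ η * c / 2 := by
    have : s ≤ η * c / (4 * M) := min_le_right _ _
    rw [le_div_iff₀ (by positivity)] at this
    linarith
  -- `S + 1` rather than `S`, since `S` may be zero.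
  refine ⟨η * c / (2 * M * (S + 1)), s, by positivity, hs0, ?_⟩
  intro a b ε has hbs ha1 hneab hε0 hε ω N hN
  have hsmall : 2 * s * M + ε * M * S ≤ η * c := by
    rw [lt_div_iff₀ (by positivity)] at hε
    have : 0 < ε * M := by positivity
    nlinarith
  obtain ⟨hdet1, hI1⟩ := abs_integral_log_norm_det_sub_le hFp hGp hF hG habs1 hc hlow1
    (fun x => (hM1 x).1) (fun x => (hM1 x).2) hS has hbs ha1 hε0.le hη0.le hη1 hsmall ω N
  obtain ⟨-, hI2⟩ := abs_integral_log_norm_det_sub_le hFp hGp hF hG habs2 hc hlow2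
    (fun x => (hM2 x).1) (fun x => (hM2 x).2) hS has hbs ha1 hε0.le hη0.le hη1 hsmall ω N
  have hnedet : ∃ z ∈ strip δ, (holMatrix F G φ ε ω N a b z).det ≠ 0 :=
    ⟨_, line_mem_strip habs1 0, hdet1 0⟩
  refine ⟨hnedet, ?_⟩
  -- Midpoint convexity at heights `0`, `y`, `2y`: the mean at `0` is at least twice the one at `y`
  -- minus the one at `2y`.
  have hconv := (convexOn_integral_log_norm (periodic_det_holMatrix hFp hGp φ ε ω N a b)
    (differentiableOn_det_holMatrix hF hG φ ε ω N a b) hnedet).2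
    (abs_lt.1 habs0) (abs_lt.1 habs2) (by norm_num : (0 : ℝ) ≤ 1 / 2)
    (by norm_num : (0 : ℝ) ≤ 1 / 2) (by norm_num)
  have hmid : (1 / 2 : ℝ) • (0 : ℝ) + (1 / 2 : ℝ) • (2 * y) = y := by
    simp only [smul_eq_mul]; ring
  rw [hmid] at hconv
  simp only [Complex.ofReal_zero, zero_mul, add_zero, smul_eq_mul] at hconv
  have hHab := differentiableOn_combo hF hG a b
  have hle := husc (fun x => combo F G a b x) (intervalIntegrable_log_norm_ofReal hδ hHab)
    (ae_ne_zero_ofReal hδ hHab hneab) fun x _ => by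
      have heq : combo F G a b x - combo F G a₀ b₀ x =
          ((a - a₀ : ℝ) : ℂ) * G x - ((b - b₀ : ℝ) : ℂ) * F x := by
        simp only [combo]; push_cast; ring
      rw [heq]
      refine (norm_sub_le _ _).trans ?_
      rw [norm_mul, norm_mul, Complex.norm_real, Complex.norm_real, Real.norm_eq_abs,
        Real.norm_eq_abs]
      have := mul_le_mul has (hM0 x).2 (norm_nonneg _) hs0.le
      have := mul_le_mul hbs (hM0 x).1 (norm_nonneg _) hs0.le
      linarith
  have hN' : (0 : ℝ) < N := by exact_mod_cast hN
  rw [one_div, lt_inv_mul_iff₀ hN']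
  set J := ∫ x in (0 : ℝ)..1, Real.log ‖combo F G a b x‖
  set J0 := ∫ x in (0 : ℝ)..1, Real.log ‖combo F G a₀ b₀ x‖
  set J1 := ∫ x in (0 : ℝ)..1, Real.log ‖combo F G a₀ b₀ (x + y * Complex.I)‖
  set J2 := ∫ x in (0 : ℝ)..1, Real.log ‖combo F G a₀ b₀ (x + (2 * y : ℝ) * Complex.I)‖
  rw [abs_le] at hI1 hI2
  -- The error `2η` per site counts twice at height `y` and once at `2y`.
  have hkey : J - κ < 2 * J1 - J2 - 6 * η := by linarith
  have := mul_lt_mul_of_pos_left hkey hN'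
  linarith [hI1.1, hI2.2]

theorem strip_mono {δ δ' : ℝ} (h : δ ≤ δ') : strip δ ⊆ strip δ' := fun _ hz => lt_of_lt_of_le hz h

theorem combo_ofReal {F G : ℂ → ℂ} {f g : ℝ → ℝ} (hFf : ∀ x : ℝ, F x = f x)
    (hGg : ∀ x : ℝ, G x = g x) (a b x : ℝ) :
    combo F G a b x = ((a * g x - b * f x : ℝ) : ℂ) := by
  simp only [combo, hFf, hGg]; push_cast; ring

theorem holMatrix_ofReal {F G : ℂ → ℂ} {f g : ℝ → ℝ} (hFf : ∀ x : ℝ, F x = f x)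
    (hGg : ∀ x : ℝ, G x = g x) (φ : ℝ → ℝ) (ε ω : ℝ) (N : ℕ) (E x : ℝ) :
    holMatrix F G φ ε ω N (1 / Real.sqrt (1 + E ^ 2)) (E / Real.sqrt (1 + E ^ 2)) x
      = matrixB f g φ ε ω N x E := by
  ext n n'
  simp only [holMatrix, matrixB, Matrix.of_apply, ← Complex.ofReal_add, combo_ofReal hFf hGg, hFf]
  split_ifs
  · congr 1; ring
  · rw [← Complex.ofReal_mul]
    congr 2; ring

/-! ### Uniformity in the energy by compactness -/

/-- Nondegeneracy of every nontrivial combination of `f` and `g`. -/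
theorem exists_combo_ne_zero {f g : ℝ → ℝ} (hf_nonconst : ¬ ∃ c : ℝ, ∀ x : ℝ, f x = c)
    (hv_nonconst : ¬ ∃ c : ℝ, ∀ x : ℝ, f x ≠ 0 → g x / f x = c) {a b : ℝ}
    (hab : a ^ 2 + b ^ 2 = 1) : ∃ x : ℝ, a * g x - b * f x ≠ 0 := by
  by_contra! h
  -- The case `a = 0` is the limit of infinite energy, where the combination is a multiple of `f`.
  by_cases ha : a = 0
  · subst ha
    have hb : b ≠ 0 := by rintro rfl; norm_num at hab
    exact hf_nonconst ⟨0, fun x => by simpa [hb] using h x⟩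
  · refine hv_nonconst ⟨b / a, fun x hx => ?_⟩
    rw [div_eq_div_iff hx ha]
    linarith [h x]

theorem isCompact_unitCircle : IsCompact {p : ℝ × ℝ | p.1 ^ 2 + p.2 ^ 2 = 1} := by
  refine Metric.isCompact_of_isClosed_isBounded (isClosed_eq (by fun_prop) continuous_const) ?_
  refine (isBounded_closedBall (x := (0 : ℝ × ℝ)) (r := 1)).subset fun p hp => ?_
  have hp' : p.1 ^ 2 + p.2 ^ 2 = 1 := hp
  rw [mem_closedBall_zero_iff, Prod.norm_def, Real.norm_eq_abs, Real.norm_eq_abs]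
  exact max_le (abs_le_one_iff_mul_self_le_one.2 (by nlinarith [sq_nonneg p.2]))
    (abs_le_one_iff_mul_self_le_one.2 (by nlinarith [sq_nonneg p.1]))

/-- The determinant estimate, uniformly over the unit circle of parameters `(a, b)`. -/
theorem exists_uniform_bound {δ : ℝ} (hδ : 0 < δ) {F G : ℂ → ℂ} {φ : ℝ → ℝ}
    (hFp : Function.Periodic F 1) (hGp : Function.Periodic G 1)
    (hF : DifferentiableOn ℂ F (strip δ)) (hG : DifferentiableOn ℂ G (strip δ))
    (hφ : ∃ ρ : ℝ, 0 < ρ ∧ ∀ n : ℤ, ‖fourierHat φ n‖ < Real.exp (-ρ * |(n : ℝ)|))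
    (hne : ∀ a b : ℝ, a ^ 2 + b ^ 2 = 1 → ∃ z ∈ strip δ, combo F G a b z ≠ 0)
    {κ : ℝ} (hκ : 0 < κ) :
    ∃ ε₁ : ℝ, 0 < ε₁ ∧ ∀ a b : ℝ, a ^ 2 + b ^ 2 = 1 → ∀ ε : ℝ, 0 < ε → ε < ε₁ →
      ∀ (ω : ℝ) (N : ℕ), 0 < N →
      (∃ z ∈ strip δ, (holMatrix F G φ ε ω N a b z).det ≠ 0) ∧
      (∫ x in (0 : ℝ)..1, Real.log ‖combo F G a b x‖) - κ <
        (1 / (N : ℝ)) * ∫ x in (0 : ℝ)..1, Real.log ‖(holMatrix F G φ ε ω N a b x).det‖ := by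
  let K : Set (ℝ × ℝ) := {p | p.1 ^ 2 + p.2 ^ 2 = 1}
  -- Having a common `ε₁` passes to subsets and finite unions, so it only needs checking near each
  -- point. Membership in `K` is kept inside `P` because the neighbourhoods leave the circle.
  let P : Set (ℝ × ℝ) → Prop := fun t => ∃ ε₁ : ℝ, 0 < ε₁ ∧ ∀ p ∈ t, p ∈ K →
    ∀ ε : ℝ, 0 < ε → ε < ε₁ → ∀ (ω : ℝ) (N : ℕ), 0 < N →
      (∃ z ∈ strip δ, (holMatrix F G φ ε ω N p.1 p.2 z).det ≠ 0) ∧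
      (∫ x in (0 : ℝ)..1, Real.log ‖combo F G p.1 p.2 x‖) - κ <
        (1 / (N : ℝ)) * ∫ x in (0 : ℝ)..1, Real.log ‖(holMatrix F G φ ε ω N p.1 p.2 x).det‖
  have hP : P K := by
    refine isCompact_unitCircle.induction_on (p := P) ⟨1, one_pos, fun p hp => hp.elim⟩
      ?_ ?_ ?_
    · rintro t t' htt' ⟨ε₁, hε₁, h⟩
      exact ⟨ε₁, hε₁, fun p hp => h p (htt' hp)⟩
    · rintro t t' ⟨ε₁, hε₁, h⟩ ⟨ε₂, hε₂, h'⟩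
      refine ⟨min ε₁ ε₂, lt_min hε₁ hε₂, fun p hp hpK ε hε hlt => ?_⟩
      rcases hp with hp | hp
      · exact h p hp hpK ε hε (hlt.trans_le (min_le_left _ _))
      · exact h' p hp hpK ε hε (hlt.trans_le (min_le_right _ _))
    · intro p₀ hp₀
      obtain ⟨ε₁, s, hε₁, hs, h⟩ :=
        exists_local_bound hδ hFp hGp hF hG hφ (hne p₀.1 p₀.2 hp₀) hκ
      refine ⟨closedBall p₀ s, mem_nhdsWithin_of_mem_nhds (closedBall_mem_nhds _ hs), ε₁, hε₁,
        fun p hp hpK ε hε hlt => ?_⟩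
      have hpK' : p.1 ^ 2 + p.2 ^ 2 = 1 := hpK
      rw [mem_closedBall, Prod.dist_eq, max_le_iff, Real.dist_eq, Real.dist_eq] at hp
      exact h p.1 p.2 ε hp.1 hp.2
        (abs_le_one_iff_mul_self_le_one.2 (by nlinarith [sq_nonneg p.2])) (hne p.1 p.2 hpK) hε hlt
  obtain ⟨ε₁, hε₁, h⟩ := hP
  exact ⟨ε₁, hε₁, fun a b hab => h (a, b) hab hab⟩

end

end SingularLongRange

/-! ### The main estimate -/

theorem lemma4p1 (f g φ : ℝ → ℝ)
    (hf : SingularLongRange.IsAnalyticOnCircle f)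
    (hg : SingularLongRange.IsAnalyticOnCircle g)
    (hφ : SingularLongRange.IsAnalyticOnCircle φ)
    (hf_nonconst : ¬ ∃ c : ℝ, ∀ x : ℝ, f x = c)
    (hv_nonconst : ¬ ∃ c : ℝ, ∀ x : ℝ, f x ≠ 0 → g x / f x = c)
    (hf_zero : ∃ x : ℝ, f x = 0)
    (hf_norm : ∀ x : ℝ, |f x| ≤ 1)
    (hφ_zero : SingularLongRange.fourierHat φ 0 = 0)
    (hφ_decay : ∃ ρ : ℝ, 0 < ρ ∧
      ∀ n : ℤ, ‖SingularLongRange.fourierHat φ n‖ < Real.exp (-ρ * |(n : ℝ)|)) :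
    ∀ κ : ℝ, 0 < κ → ∃ ε₁ : ℝ, 0 < ε₁ ∧
      ∀ ε₀ : ℝ, 0 < ε₀ → ε₀ ≤ ε₁ →
      ∀ ε : ℝ, 0 < ε → ε < ε₀ →
      ∀ ω : ℝ, SingularLongRange.IsDiophantine ω →
      ∀ (N : ℕ), 0 < N → ∀ E : ℝ,
        (∀ᵐ x : ℝ, (SingularLongRange.matrixB f g φ ε ω N x E).det ≠ 0) ∧
        IntervalIntegrable
          (fun x : ℝ => Real.log ‖(SingularLongRange.matrixB f g φ ε ω N x E).det‖)
          MeasureTheory.volume 0 1 ∧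
        (∀ᵐ x : ℝ, g x - E * f x ≠ 0) ∧
        IntervalIntegrable
          (fun x : ℝ => Real.log (|g x - E * f x| / Real.sqrt (1 + E ^ 2)))
          MeasureTheory.volume 0 1 ∧
        (1 / (N : ℝ)) *
            ∫ x in (0 : ℝ)..1,
              Real.log ‖(SingularLongRange.matrixB f g φ ε ω N x E).det‖ >
          (∫ x in (0 : ℝ)..1, Real.log (|g x - E * f x| / Real.sqrt (1 + E ^ 2))) -
            (κ + ε₀ ^ ((1 : ℝ) / 4)) := by
  intro κ hκ
  obtain ⟨δ₁, hδ₁, F, hFp, hF₁, hFf⟩ := hf.exists_extension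
  obtain ⟨δ₂, hδ₂, G, hGp, hG₂, hGg⟩ := hg.exists_extension
  obtain ⟨δ, hδ, hF, hG⟩ : ∃ δ : ℝ, 0 < δ ∧ DifferentiableOn ℂ F (SingularLongRange.strip δ) ∧
      DifferentiableOn ℂ G (SingularLongRange.strip δ) :=
    ⟨min δ₁ δ₂, lt_min hδ₁ hδ₂, hF₁.mono (SingularLongRange.strip_mono (min_le_left _ _)),
      hG₂.mono (SingularLongRange.strip_mono (min_le_right _ _))⟩
  have hne : ∀ a b : ℝ, a ^ 2 + b ^ 2 = 1 →
      ∃ z ∈ SingularLongRange.strip δ, SingularLongRange.combo F G a b z ≠ 0 := by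
    intro a b hab
    obtain ⟨x, hx⟩ := SingularLongRange.exists_combo_ne_zero hf_nonconst hv_nonconst hab
    refine ⟨x, by simpa [SingularLongRange.mem_strip] using hδ, ?_⟩
    rw [SingularLongRange.combo_ofReal hFf hGg]
    exact_mod_cast hx
  obtain ⟨ε₁, hε₁, hmain⟩ :=
    SingularLongRange.exists_uniform_bound hδ hFp hGp hF hG hφ_decay hne hκ
  refine ⟨ε₁, hε₁, fun ε₀ hε₀ hε₀₁ ε hε hεε₀ ω _ N hN E => ?_⟩
  have hr : 0 < Real.sqrt (1 + E ^ 2) := Real.sqrt_pos.2 (by positivity)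
  have hab : (1 / Real.sqrt (1 + E ^ 2)) ^ 2 + (E / Real.sqrt (1 + E ^ 2)) ^ 2 = 1 := by
    rw [div_pow, div_pow, Real.sq_sqrt (by positivity), ← add_div, one_pow,
      div_self (by positivity)]
  obtain ⟨hdet, hlt⟩ := hmain _ _ hab ε hε (hεε₀.trans_le hε₀₁) ω N hN
  have hD := SingularLongRange.differentiableOn_det_holMatrix hF hG φ ε ω N
    (1 / Real.sqrt (1 + E ^ 2)) (E / Real.sqrt (1 + E ^ 2))
  have hC := SingularLongRange.differentiableOn_combo hF hG
    (1 / Real.sqrt (1 + E ^ 2)) (E / Real.sqrt (1 + E ^ 2))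
  have hcombo : ∀ x : ℝ, SingularLongRange.combo F G (1 / Real.sqrt (1 + E ^ 2))
      (E / Real.sqrt (1 + E ^ 2)) x = (((g x - E * f x) / Real.sqrt (1 + E ^ 2) : ℝ) : ℂ) := by
    intro x
    rw [SingularLongRange.combo_ofReal hFf hGg]
    congr 1
    ring
  have hnorm : ∀ x : ℝ, ‖SingularLongRange.combo F G (1 / Real.sqrt (1 + E ^ 2))
      (E / Real.sqrt (1 + E ^ 2)) x‖ = |g x - E * f x| / Real.sqrt (1 + E ^ 2) := by
    intro x
    rw [hcombo, Complex.norm_real, Real.norm_eq_abs, abs_div, abs_of_pos hr]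
  have hDae := SingularLongRange.ae_ne_zero_ofReal hδ hD hdet
  have hDint := SingularLongRange.intervalIntegrable_log_norm_ofReal hδ hD
  have hCae := SingularLongRange.ae_ne_zero_ofReal hδ hC (hne _ _ hab)
  have hCint := SingularLongRange.intervalIntegrable_log_norm_ofReal hδ hC
  simp only [SingularLongRange.holMatrix_ofReal hFf hGg] at hDae hDint hlt
  simp only [hnorm] at hCint hlt
  refine ⟨hDae, hDint, ?_, hCint, ?_⟩
  · filter_upwards [hCae] with x hx h0
    exact hx (by rw [hcombo, h0]; simp)
  -- The bound already holds with loss `κ`; the positive extra term only weakens it.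
  · have : 0 < ε₀ ^ ((1 : ℝ) / 4) := Real.rpow_pos_of_pos hε₀ _
    linarith
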